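/- **Separate compilation correctness.** Component and procedure names are natural numbers; the main procedure is procedure $0$ of component $0$. An *interface* is a finite set of imported procedures $C.P$ and a finite set of exported procedure names. *Source language.* Expressions are $e ::= i \mid e_1\otimes e_2 \mid \mathtt{if}\ e\ \mathtt{then}\ e_1\ \mathtt{else}\ e_2 \mid b[e] \mid b[e_1]:=e_2 \mid C.P(e)\mid\mathtt{exit}$ with $i\in\mathbb Z$ and $\otimes\in\{;,+,-,\times,=,\le\}$ (truth values are $0/1$, $\mathtt{if}$ tests for $\neq 0$, an assignment evaluates to the assigned value). A component consists of an interface, local buffers $0,1,\dots$ with initial contents in $\mathbb Z$, and procedure bodies $0,1,\dots$. It is well formed if it defines all procedures it exports, its buffer $0$ has at least one cell, every buffer it uses is defined, and it only calls its own procedures or external procedures that it imports. Programs and contexts are partial maps from names to components, and $A[P]$ is the union of the two maps. Configurations $(C,s,\sigma,K,e)$ (current component, buffer contents, call stack, continuation, current expression) reduce by the standard deterministic left-to-right continuation semantics. A call $C'.P'(i)$ writes $i$ to $s[C',0,0]$ and pushes $(C,s[C,0,0],K)$ on $\sigma$; its return pops this triple and restores $s[C,0,0]$. Evaluation starts as a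 call of the main procedure with argument $0$. A configuration is final if $e=\mathtt{exit}$, or if $e$ is a value and $K,\sigma$ are empty. It is an *undefined behavior configuration* if its next operation is an out-of-bounds buffer read or write; such a configuration is stuck. A program terminates if it reaches a final configuration, and diverges if it has an infinite reduction. *Target machine.* Words are integers, with a partial decoding function onto instructions (every instruction has an encoding; the statement holds for every such coding). A program is a family of infinite private compartment memories indexed by component names, together with a map from procedures to entry points; $a[p]$ is the union. The instructions are Nop, Const, Mov, Load, Store, Jump, Jal, Call, Return, Binop, Bnz and Halt; loads, stores and jumps act within the current compartment. $\mathrm{Call}\ C'\ P'$ requires that $C'$ is the current compartment or that the current compartment's interface imports $C'.P'$; it pushes the compartment and return address on a protected call stack and goes to the entry point of $C'.P'$. Return pops this stack. Execution starts at the entry point of the main procedure with an empty call stack and zeroed registers. Termination means reaching a state with no successor (for instance Halt, or Return on an empty call stack); divergence means an infinite run. *Compiler.* $\downarrow$ maps each component separately to one compartment, split into a cell for the saved local stack pointer, the buffers, the procedures' code, and an upward-growing local stack; it provides entry points for exactly the exported procedures. Expressions are compiled to stack-based code with the result in a register $r_{com}$, without bounds checks. Around each call the current call argument is saved on, and restored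 from, the local stack. Calls within a component use Jal/Jump with separate local entry points. On a cross-component Call or Return, the local stack pointer is saved at a fixed address and all registers but $r_{com}$ are set to $0$; on regaining control the stack pointer is restored. *Shapes.* A shape $s$ is a partial map from component names to interfaces together with a set of uncompromised names. It is well formed if every imported procedure belongs to a component of the shape and is exported by it, and the main procedure is exported by component $0$ of the shape. $P$ has shape $\bullet s$ (resp. $A$ has shape $\circ s$) if it defines exactly the components of $s$ that are uncompromised (resp. not uncompromised), by well-formed components with the interfaces given by $s$. $P$ of shape $\bullet s$ is *fully defined* with respect to contexts of shape $\circ s$ if for every $A$ of shape $\circ s$, whenever reducing $A[P]$ reaches an undefined behavior configuration, the current component of that configuration belongs to $A$. Dually, $A$ of shape $\circ s$ is fully defined with respect to programs of shape $\bullet s$ if for every $P$ of shape $\bullet s$, whenever reducing $A[P]$ reaches an undefined behavior configuration, its current component belongs to $P$. **Corollary.** Let $s$ be a well-formed shape, $A$ a context of shape $\circ s$ and $P$ a program of shape $\bullet s$. If $P$ is fully defined with respect to contexts of shape $\circ s$ and $A$ is fully defined with respect to programs of shape $\bullet s$, then 1. $A[P]$ terminates if and only if $\downarrow\! A[\downarrow\!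 P]$ terminates, and 2. $A[P]$ diverges if and only if $\downarrow\! A[\downarrow\! P]$ diverges, where $\downarrow\! A[\downarrow\! P]$ runs with the component interfaces of $s$. -/

import Mathlib

/-! Component and procedure names are natural numbers.  The main component is component `0`
and the main procedure is its procedure `0`. -/

/-- The name of the fixed main component. -/
def mainComp : ℕ := 0

/-- The name of the fixed main procedure of the main component. -/
def mainProc : ℕ := 0

/-- A component interface: the procedures `(C, P)` that are imported, and the names of the
procedures that are made public. -/
structure Interface where
  imported : Finset (ℕ × ℕ)
  exported : Finset ℕ

/-- The binary operators, common to the source language and the machine. -/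
inductive BinOp
  | seq | add | sub | mul | eq | le
  deriving DecidableEq, Encodable

/-- Meaning of the binary operators; truth values are `1` and `0`, and `seq` keeps its
second argument. -/
def BinOp.eval : BinOp → ℤ → ℤ → ℤ
  | .seq, _, b => b
  | .add, a, b => a + b
  | .sub, a, b => a - b
  | .mul, a, b => a * b
  | .eq, a, b => if a = b then 1 else 0
  | .le, a, b => if a ≤ b then 1 else 0

/-! ### Source language -/

namespace Src

/-- Expressions. -/
inductive Expr
  | val (i : ℤ)
  | bin (op : BinOp) (e₁ e₂ : Expr)
  | ite (e e₁ e₂ : Expr)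
  | read (b : ℕ) (e : Expr)
  | write (b : ℕ) (e₁ e₂ : Expr)
  | call (C P : ℕ) (e : Expr)
  | exit

/-- Component definitions: the interface, the local buffers `0, 1, …` with their initial
contents, and the bodies of the procedures `0, 1, …`. -/
structure Component where
  iface : Interface
  buffers : List (List ℤ)
  procs : List Expr

/-- All buffers used by an expression of component `C` (whose definition is `c`) are defined;
all calls go to procedures that `C` defines itself or that are external and imported. -/
def Expr.WF (C : ℕ) (c : Component) : Expr → Prop
  | .val _ => True
  | .bin _ e₁ e₂ => e₁.WF C c ∧ e₂.WF C c
  | .ite e e₁ e₂ => e.WF C c ∧ e₁.WF C c ∧ e₂.WF C c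
  | .read b e => b < c.buffers.length ∧ e.WF C c
  | .write b e₁ e₂ => b < c.buffers.length ∧ e₁.WF C c ∧ e₂.WF C c
  | .call C' P e =>
      ((C' = C ∧ P < c.procs.length) ∨ (C' ≠ C ∧ (C', P) ∈ c.iface.imported)) ∧ e.WF C c
  | .exit => True

/-- The definition `c` of the component named `C` satisfies its interface and is well formed:
it defines every procedure it makes public, the cell in which procedures receive their argument
(first cell of the first buffer) exists, and all procedure bodies are well formed. -/
structure Component.WF (C : ℕ) (c : Component) : Prop where
  exported_defined : ∀ P ∈ c.iface.exported, P < c.procs.length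
  arg_cell : ∃ buf ∈ c.buffers[0]?, 0 < buf.length
  procs_wf : ∀ e ∈ c.procs, e.WF C c

/-- Partial programs, contexts and complete programs are mappings from component names to
component definitions. -/
abbrev Program := ℕ → Option Component

/-- Context application `A[P]`: union of the two mappings. -/
def link (A P : Program) : Program := fun C => (A C).or (P C)

/-- The procedure bodies `Δ` of a program. -/
def Program.body (P : Program) (C k : ℕ) : Option Expr :=
  (P C).bind fun c => c.procs[k]?

/-- The contents of the local buffers of each component. -/
abbrev BufState := ℕ → List (List ℤ)

/-- `s[C,b,i]`, which is undefined (`none`) out of bounds. -/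
def BufState.get (s : BufState) (C b : ℕ) (i : ℤ) : Option ℤ :=
  if 0 ≤ i then (s C)[b]?.bind fun buf => buf[i.toNat]? else none

/-- `s[C,b,i ↦ v]`, which is undefined (`none`) out of bounds. -/
def BufState.set (s : BufState) (C b : ℕ) (i v : ℤ) : Option BufState :=
  if (s.get C b i).isSome then
    some (Function.update s C ((s C).modify b fun buf => buf.set i.toNat v))
  else none

/-- Flat evaluation contexts. -/
inductive Frame
  | binL (op : BinOp) (e₂ : Expr)
  | binR (op : BinOp) (i₁ : ℤ)
  | ite (e₁ e₂ : Expr)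
  | read (b : ℕ)
  | writeL (b : ℕ) (e₂ : Expr)
  | writeR (b : ℕ) (i₁ : ℤ)
  | call (C P : ℕ)

/-- Continuations. -/
abbrev Cont := List Frame

/-- Configurations `(C, s, σ, K, e)`.  An element `(C', i', K')` of the call stack `σ` holds the
calling component, the argument of the call that was in progress there, and its continuation. -/
structure Config where
  comp : ℕ
  bufs : BufState
  stack : List (ℕ × ℤ × Cont)
  cont : Cont
  expr : Expr

/-- One reduction step, where `Δ` gives the procedure bodies; `none` means that the
configuration does not reduce. -/
def step (Δ : ℕ → ℕ → Option Expr) : Config → Option Config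
  | ⟨C, s, σ, K, .bin op e₁ e₂⟩ => some ⟨C, s, σ, .binL op e₂ :: K, e₁⟩
  | ⟨C, s, σ, K, .ite e e₁ e₂⟩ => some ⟨C, s, σ, .ite e₁ e₂ :: K, e⟩
  | ⟨C, s, σ, K, .read b e⟩ => some ⟨C, s, σ, .read b :: K, e⟩
  | ⟨C, s, σ, K, .write b e₁ e₂⟩ => some ⟨C, s, σ, .writeL b e₂ :: K, e₁⟩
  | ⟨C, s, σ, K, .call C' P' e⟩ => some ⟨C, s, σ, .call C' P' :: K, e⟩
  | ⟨C, s, σ, .binL op e₂ :: K, .val i⟩ => some ⟨C, s, σ, .binR op i :: K, e₂⟩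
  | ⟨C, s, σ, .binR op i₁ :: K, .val i⟩ => some ⟨C, s, σ, K, .val (op.eval i₁ i)⟩
  | ⟨C, s, σ, .ite e₁ e₂ :: K, .val i⟩ => some ⟨C, s, σ, K, if i ≠ 0 then e₁ else e₂⟩
  | ⟨C, s, σ, .read b :: K, .val i⟩ =>
      (s.get C b i).bind fun v => some ⟨C, s, σ, K, .val v⟩
  | ⟨C, s, σ, .writeL b e₂ :: K, .val i⟩ => some ⟨C, s, σ, .writeR b i :: K, e₂⟩
  | ⟨C, s, σ, .writeR b i₁ :: K, .val i⟩ =>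
      (s.set C b i₁ i).bind fun s' => some ⟨C, s', σ, K, .val i⟩
  | ⟨C, s, σ, .call C' P' :: K, .val i⟩ =>
      (s.get C 0 0).bind fun a =>
      (s.set C' 0 0 i).bind fun s' =>
      (Δ C' P').bind fun e => some ⟨C', s', (C, a, K) :: σ, [], e⟩
  | ⟨_, s, (C', i', K) :: σ, [], .val i⟩ =>
      (s.set C' 0 0 i').bind fun s' => some ⟨C', s', σ, K, .val i⟩
  | ⟨_, _, [], [], .val _⟩ => none
  | ⟨_, _, _, _, .exit⟩ => none

/-- Final configurations: the current expression is `exit`, or the initial call has completed. -/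
def Config.Final (c : Config) : Prop :=
  c.expr = .exit ∨ ((∃ i, c.expr = .val i) ∧ c.cont = [] ∧ c.stack = [])

/-- Undefined behavior configurations: the next operation reads or updates a buffer
out of bounds. -/
def Config.Undef (c : Config) : Prop :=
  (∃ b i K, c.cont = .read b :: K ∧ c.expr = .val i ∧ c.bufs.get c.comp b i = none) ∨
  (∃ b i i' K, c.cont = .writeR b i :: K ∧ c.expr = .val i' ∧ c.bufs.get c.comp b i = none)

/-- The initial contents of the buffers. -/
def Program.initBufs (P : Program) : BufState := fun C => ((P C).map Component.buffers).getD []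

/-- Evaluation starts as a call to the main procedure (with argument `0`). -/
def Program.init (P : Program) : Option Config :=
  (P.initBufs.set mainComp 0 0 0).bind fun s =>
  (P.body mainComp mainProc).bind fun e => some ⟨mainComp, s, [], [], e⟩

/-- `cfg` is reached when the complete program `P` is reduced. -/
def Program.Reaches (P : Program) (cfg : Config) : Prop :=
  ∃ c₀, P.init = some c₀ ∧
    Relation.ReflTransGen (fun c c' => step P.body c = some c') c₀ cfg

/-- The complete program `P` terminates. -/
def Program.Terminates (P : Program) : Prop := ∃ cfg, P.Reaches cfg ∧ cfg.Final

/-- The complete program `P` diverges. -/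
def Program.Diverges (P : Program) : Prop :=
  ∃ f : ℕ → Config, P.init = some (f 0) ∧ ∀ n, step P.body (f n) = some (f (n + 1))

end Src

/-! ### Shapes -/

/-- Program shapes: a mapping from component names to interfaces and the set of
uncompromised components. -/
structure Shape where
  iface : ℕ → Option Interface
  uncompromised : Set ℕ

/-- Well-formed shapes: a procedure that is imported belongs to a component of the shape and is
made public by it, and so is the main procedure. -/
structure Shape.WF (s : Shape) : Prop where
  imported_exported : ∀ C I, s.iface C = some I → ∀ q ∈ I.imported,
    ∃ J, s.iface q.1 = some J ∧ q.2 ∈ J.exported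
  main_exported : ∃ I, s.iface mainComp = some I ∧ mainProc ∈ I.exported

namespace Src

/-- `P` defines exactly the components of the shape `s` whose name is in `S`, with well-formed
definitions that satisfy the interfaces given by `s`. -/
structure Program.DefinesExactly (P : Program) (s : Shape) (S : Set ℕ) : Prop where
  dom : ∀ C, (P C).isSome ↔ (s.iface C).isSome ∧ C ∈ S
  iface : ∀ C c, P C = some c → s.iface C = some c.iface
  wf : ∀ C c, P C = some c → c.WF C

/-- The partial program `P` has shape `•s`. -/
def Program.HasShape (P : Program) (s : Shape) : Prop := P.DefinesExactly s s.uncompromised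

/-- The context `A` has shape `∘s`. -/
def Program.CtxHasShape (A : Program) (s : Shape) : Prop := A.DefinesExactly s s.uncompromisedᶜ

/-- `P` is fully defined with respect to contexts of shape `∘s`: whenever reducing `A[P]` reaches
an undefined behavior configuration, the current component there belongs to `A`. -/
def Program.FullyDefined (P : Program) (s : Shape) : Prop :=
  ∀ A : Program, A.CtxHasShape s →
    ∀ cfg, (link A P).Reaches cfg → cfg.Undef → (A cfg.comp).isSome

/-- `A` is fully defined with respect to programs of shape `•s`: whenever reducing `A[P]` reaches
an undefined behavior configuration, the current component there belongs to `P`. -/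
def Program.CtxFullyDefined (A : Program) (s : Shape) : Prop :=
  ∀ P : Program, P.HasShape s →
    ∀ cfg, (link A P).Reaches cfg → cfg.Undef → (P cfg.comp).isSome

end Src

/-! ### Target machine -/

namespace Tgt

/-- Registers: `com` holds call arguments and return values, `sp` the local stack pointer,
`ra` the return address set by `jal`; `aux₁` and `aux₂` are auxiliary. -/
inductive Reg
  | com | aux₁ | aux₂ | sp | ra
  deriving DecidableEq, Encodable

/-- Instructions.  Words are unbounded integers. -/
inductive Instr
  | nop
  | const (i : ℤ) (rd : Reg)
  | mov (rs rd : Reg)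
  | load (rp rd : Reg)
  | store (rp rs : Reg)
  | jump (r : Reg)
  | jal (r : Reg)
  | call (C P : ℕ)
  | ret
  | binop (op : BinOp) (r₁ r₂ rd : Reg)
  | bnz (r : Reg) (i : ℤ)
  | halt
  deriving Encodable

/-- A representation of instructions as words: the machine has a partial decoding function, and
every instruction is the decoding of some word, chosen by `encode`. -/
structure Coding where
  encode : Instr → ℤ
  decode : ℤ → Option Instr
  decode_encode : ∀ i, decode (encode i) = some i

instance : Nonempty Coding :=
  ⟨{ encode := fun i => (Encodable.encode i : ℤ)
     decode := fun w => Encodable.decode w.toNat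
     decode_encode := fun i => by simp }⟩

/-- The memory of one compartment; it is infinite. -/
abbrev Mem := ℤ → ℤ

/-- Low-level partial programs, contexts and complete programs: a memory that is partitioned into
named compartments, and a mapping from procedure identifiers to entry points. -/
structure Program where
  mem : ℕ → Option Mem
  entry : ℕ → ℕ → Option ℤ

/-- Context application `a[p]` in the target. -/
def link (a p : Program) : Program where
  mem := fun C => (a.mem C).or (p.mem C)
  entry := fun C P => (a.entry C P).or (p.entry C P)

/-- Machine states `(C, σ, mem, reg, pc)`. -/
structure State where
  comp : ℕ
  stack : List (ℕ × ℤ)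
  mem : ℕ → Option Mem
  reg : Reg → ℤ
  pc : ℤ

/-- Execution of one decoded instruction, where `m` is the memory of the current compartment;
`none` means that the machine is stuck. -/
def exec (ψ : ℕ → Option Interface) (E : ℕ → ℕ → Option ℤ) (st : State) (m : Mem) :
    Instr → Option State
  | .nop => some { st with pc := st.pc + 1 }
  | .const i rd => some { st with reg := Function.update st.reg rd i, pc := st.pc + 1 }
  | .mov rs rd => some { st with reg := Function.update st.reg rd (st.reg rs), pc := st.pc + 1 }
  | .load rp rd =>
      some { st with reg := Function.update st.reg rd (m (st.reg rp)), pc := st.pc + 1 }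
  | .store rp rs =>
      some { st with
        mem := Function.update st.mem st.comp
          (some (Function.update m (st.reg rp) (st.reg rs)))
        pc := st.pc + 1 }
  | .jump r => some { st with pc := st.reg r }
  | .jal r => some { st with reg := Function.update st.reg .ra (st.pc + 1), pc := st.reg r }
  | .call C' P' =>
      if C' = st.comp ∨ ∃ I ∈ ψ st.comp, (C', P') ∈ I.imported then
        (E C' P').bind fun pc' =>
          some { st with comp := C', stack := (st.comp, st.pc + 1) :: st.stack, pc := pc' }
      else none
  | .ret =>
      match st.stack with
      | [] => none
      | (C', pc') :: σ => some { st with comp := C', stack := σ, pc := pc' }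
  | .binop op r₁ r₂ rd =>
      some { st with
        reg := Function.update st.reg rd (op.eval (st.reg r₁) (st.reg r₂)), pc := st.pc + 1 }
  | .bnz r i => some { st with pc := if st.reg r ≠ 0 then st.pc + i else st.pc + 1 }
  | .halt => none

/-- One machine step in an environment with component interfaces `ψ` and entry points `E`. -/
def step (D : Coding) (ψ : ℕ → Option Interface) (E : ℕ → ℕ → Option ℤ) (st : State) :
    Option State :=
  (st.mem st.comp).bind fun m => (D.decode (m st.pc)).bind fun i => exec ψ E st m i

/-- Execution starts at the entry point of the main procedure, with zeroed registers. -/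
def Program.init (p : Program) : Option State :=
  (p.entry mainComp mainProc).bind fun pc => some ⟨mainComp, [], p.mem, fun _ => 0, pc⟩

/-- The complete program `p` terminates: it reaches a state without a next state. -/
def Program.Terminates (D : Coding) (ψ : ℕ → Option Interface) (p : Program) : Prop :=
  ∃ s₀ st, p.init = some s₀ ∧
    Relation.ReflTransGen (fun s s' => step D ψ p.entry s = some s') s₀ st ∧
    step D ψ p.entry st = none

/-- The complete program `p` diverges. -/
def Program.Diverges (D : Coding) (ψ : ℕ → Option Interface) (p : Program) : Prop :=
  ∃ f : ℕ → State, p.init = some (f 0) ∧ ∀ n, step D ψ p.entry (f n) = some (f (n + 1))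

end Tgt

/-! ### Compiler

The compartment of a component holds, from address `0` on: a cell in which the local stack pointer
is saved whenever control leaves the compartment; the buffers; the code of the procedures; and the
local stack, which grows upwards without bound. -/

namespace Compiler

open Src Tgt Tgt.Instr Tgt.Reg

/-- What is needed to compile an expression: the name of its component, the addresses of the
buffers, and the component-local entry points of the procedures. -/
structure Env where
  self : ℕ
  buf : ℕ → ℤ
  loc : ℕ → ℤ

/-- Push `r` (not `aux₂`) on the local stack. -/
def push (r : Reg) : List Instr := [store sp r, const 1 aux₂, binop .add sp aux₂ sp]

/-- Pop the top of the local stack into `r`. -/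
def pop (r : Reg) : List Instr := [const 1 aux₂, binop .sub sp aux₂ sp, load sp r]

/-- Write the local stack pointer to its fixed location. -/
def saveSp : List Instr := [const 0 aux₁, store aux₁ sp]

/-- Restore the local stack pointer from its fixed location. -/
def restoreSp : List Instr := [const 0 sp, load sp sp]

/-- Clean all registers except the one that holds the call argument or return value. -/
def clean : List Instr := [const 0 aux₁, const 0 aux₂, const 0 sp, const 0 ra]

/-- Save the argument of the current call on the local stack. -/
def saveArg (env : Env) : List Instr := [const (env.buf 0) aux₁, load aux₁ aux₁] ++ push aux₁

/-- Restore the argument of the current call from the local stack. -/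
def restoreArg (env : Env) : List Instr := pop aux₁ ++ [const (env.buf 0) aux₂, store aux₂ aux₁]

/-- The code of an expression; it leaves the value of the expression in register `com`. -/
def compileExpr (env : Env) : Expr → List Instr
  | .val i => [const i com]
  | .bin op e₁ e₂ =>
      compileExpr env e₁ ++ push com ++ compileExpr env e₂ ++ pop aux₁ ++ [binop op aux₁ com com]
  | .ite e e₁ e₂ =>
      compileExpr env e ++ [bnz com ((compileExpr env e₂).length + 3)] ++
      compileExpr env e₂ ++ [const 1 aux₁, bnz aux₁ ((compileExpr env e₁).length + 1)] ++
      compileExpr env e₁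
  | .read b e =>
      compileExpr env e ++ [const (env.buf b) aux₁, binop .add aux₁ com aux₁, load aux₁ com]
  | .write b e₁ e₂ =>
      compileExpr env e₁ ++ push com ++ compileExpr env e₂ ++ pop aux₁ ++
      [const (env.buf b) aux₂, binop .add aux₁ aux₂ aux₁, store aux₁ com]
  | .call C P e =>
      compileExpr env e ++ saveArg env ++
      (if C = env.self then [const (env.loc P) aux₁, jal aux₁]
       else saveSp ++ clean ++ [call C P] ++ restoreSp) ++
      restoreArg env
  | .exit => [halt]

/-- The part of the code of a procedure that starts at its entry point for calls from other
components: it restores the local stack pointer, calls the procedure locally, and returns to the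
calling component with clean registers. -/
def stub (localEntry : ℤ) : List Instr :=
  restoreSp ++ [const localEntry aux₁, jal aux₁] ++ saveSp ++ clean ++ [ret]

/-- The part of the code of a procedure that starts at its component-local entry point. -/
def localCode (env : Env) (body : Expr) : List Instr :=
  [const (env.buf 0) aux₁, store aux₁ com] ++ push ra ++ compileExpr env body ++
  pop ra ++ [jump ra]

/-- The code of a procedure. -/
def procCode (env : Env) (localEntry : ℤ) (body : Expr) : List Instr :=
  stub localEntry ++ localCode env body

/-- The length of the code of a procedure of component `C`, which does not depend on addresses. -/
def procSize (C : ℕ) (body : Expr) : ℕ := (procCode ⟨C, fun _ => 0, fun _ => 0⟩ 0 body).length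

/-- The address of buffer `b`. -/
def bufAddr (c : Component) (b : ℕ) : ℤ := 1 + (c.buffers.take b).flatten.length

/-- The entry point of procedure `k` for calls from other components. -/
def entryPoint (C : ℕ) (c : Component) (k : ℕ) : ℤ :=
  1 + c.buffers.flatten.length + ((c.procs.take k).map (procSize C)).sum

/-- The entry point of procedure `k` for calls from the same component. -/
def localEntry (C : ℕ) (c : Component) (k : ℕ) : ℤ := entryPoint C c k + (stub 0).length

/-- The environment in which the procedures of a component are compiled. -/
def compEnv (C : ℕ) (c : Component) : Env := ⟨C, bufAddr c, localEntry C c⟩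

/-- The code of all the procedures of a component. -/
def compCode (C : ℕ) (c : Component) : List Instr :=
  (c.procs.zipIdx.map fun q => procCode (compEnv C c) (localEntry C c q.2) q.1).flatten

/-- The first address of the local stack. -/
def stackBase (C : ℕ) (c : Component) : ℤ :=
  1 + c.buffers.flatten.length + (compCode C c).length

/-- The initial memory of the compartment of a component. -/
def compMem (D : Coding) (C : ℕ) (c : Component) : Mem := fun a =>
  if 0 ≤ a then
    (stackBase C c :: (c.buffers.flatten ++ (compCode C c).map D.encode)).getD a.toNat 0
  else 0

/-- Compilation of partial programs and contexts works pointwise; entry points are provided for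
exactly the procedures that are made public. -/
def compile (D : Coding) (P : Src.Program) : Tgt.Program where
  mem := fun C => (P C).map (compMem D C)
  entry := fun C k => (P C).bind fun c =>
    if k ∈ c.iface.exported then some (entryPoint C c k) else none

end Compiler

/-! Two observations reduce the claim to a forward simulation.

*Reduction to complete programs.*  The shapes make the domains of `A` and `P` disjoint, so
compilation commutes with linking (`link_compile`), and `W = A[P]` may be compiled as a whole.  A
reachable undefined behavior configuration would have its current component both in `A` and in
`P`; hence none is reachable, and a configuration of `W` gets stuck only by being final
(`Match.stuck`).  Since both step functions are deterministic, divergence is the negation of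
termination on either side, and only the equivalence of the two terminations is left.

*Simulation.*  `Match` relates a source configuration to a machine state.  In every compartment it
fixes the code, the buffer contents and the local stack (`MemInv`); `KMatch` says that the code
ahead of the program counter carries out the current continuation, whose intermediate values are on
the local stack, and `SMatch` says the same for the continuations suspended in the source call
stack, whose return addresses are on the local stacks (calls within a component) or also on the
protected call stack (calls between components).  In-bounds buffer writes, stack pushes and the
saved stack pointer never hit code or one another (`CompInv.write`, `CompInv.push`,
`CompInv.update_zero`), so the relation survives every source step (`Match.step`).  A source step
is matched either by at least one machine step, or by none, when it merely focuses on a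
subexpression; the size of the current expression decreases in the second case.  Therefore neither
side can run forever while the other is finished (`halting_iff_of_simulation`). -/

/-! ### Termination of deterministic step functions -/

section Determinism

variable {α β : Type*}

/-- For a partial function `f`, accessibility of `a` for "is the next state of" says that the
run of `f` from `a` is finite. -/
def Halting (f : α → Option α) (a : α) : Prop := Acc (fun y x => f x = some y) a

theorem halting_of_step {f : α → Option α} {a b : α} (h : f a = some b) (hb : Halting f b) :
    Halting f a :=
  ⟨a, fun y hy => by
    rw [h] at hy
    exact Option.some.inj hy ▸ hb⟩

theorem halting_of_stuck {f : α → Option α} {a : α} (h : f a = none) : Halting f a :=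
  ⟨a, fun y hy => by simp [h] at hy⟩

theorem halting_iff_of_reflTransGen {f : α → Option α} {a b : α}
    (h : Relation.ReflTransGen (fun x y => f x = some y) a b) : Halting f a ↔ Halting f b := by
  induction h with
  | refl => rfl
  | tail _ hbc ih => exact ih.trans ⟨fun hb => hb.inv hbc, halting_of_step hbc⟩

theorem halting_iff_exists_stuck {f : α → Option α} {a : α} :
    Halting f a ↔
      ∃ b, Relation.ReflTransGen (fun x y => f x = some y) a b ∧ f b = none := by
  constructor
  · intro h
    induction h with
    | intro a _ ih =>
      cases hfa : f a with
      | none => exact ⟨a, .refl, hfa⟩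
      | some a' =>
        obtain ⟨b, hb, hb'⟩ := ih a' hfa
        exact ⟨b, .head hfa hb, hb'⟩
  · rintro ⟨b, hab, hb⟩
    exact (halting_iff_of_reflTransGen hab).2 (halting_of_stuck hb)

theorem not_halting_iff_exists_run {f : α → Option α} {a : α} :
    ¬ Halting f a ↔ ∃ g : ℕ → α, g 0 = a ∧ ∀ n, f (g n) = some (g (n + 1)) := by
  constructor
  · intro h
    have next : ∀ x : {x // ¬ Halting f x}, ∃ y : {x // ¬ Halting f x}, f x.1 = some (y.1 : α) := by
      rintro ⟨x, hx⟩
      cases hfx : f x with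
      | none => exact absurd (halting_of_stuck hfx) hx
      | some y => exact ⟨⟨y, fun hy => hx (halting_of_step hfx hy)⟩, rfl⟩
    choose succ hsucc using next
    refine ⟨fun n => (succ^[n] ⟨a, h⟩).1, rfl, fun n => ?_⟩
    simp only [Function.iterate_succ_apply']
    exact hsucc _
  · rintro ⟨g, rfl, hg⟩ h
    have key : ∀ x, Halting f x → ∀ n, g n ≠ x := by
      intro x hx
      induction hx with
      | intro x _ ih =>
        rintro n rfl
        exact ih _ (hg n) (n + 1) rfl
    exact key _ h 0 rfl

/-- A forward simulation between deterministic systems reflects termination as well as it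
preserves it, as soon as source steps that are simulated by no target step decrease a measure. -/
theorem halting_iff_of_simulation {f : α → Option α} {g : β → Option β} {R : α → β → Prop}
    (μ : α → ℕ)
    (hstep : ∀ a b a', R a b → f a = some a' →
      ∃ b', R a' b' ∧ (Relation.TransGen (fun x y => g x = some y) b b' ∨ b' = b ∧ μ a' < μ a))
    (hstuck : ∀ a b, R a b → f a = none →
      ∃ b', Relation.ReflTransGen (fun x y => g x = some y) b b' ∧ g b' = none)
    {a : α} {b : β} (hab : R a b) : Halting f a ↔ Halting g b := by
  constructor
  · intro h
    induction h generalizing b with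
    | intro a _ ih =>
      cases hfa : f a with
      | none => exact halting_iff_exists_stuck.2 (hstuck a b hab hfa)
      | some a' =>
        obtain ⟨b', hR, hb | ⟨rfl, -⟩⟩ := hstep a b a' hab hfa
        · exact (halting_iff_of_reflTransGen hb.to_reflTransGen).2 (ih a' hfa hR)
        · exact ih a' hfa hR
  · intro h
    -- Lexicographic induction: on the rest of the target run, and then on `μ` for source steps
    -- that leave the target state unchanged.
    have h' := h.transGen
    clear h
    induction h' generalizing a with
    | intro b _ ih =>
      induction hn : μ a using Nat.strong_induction_on generalizing a with
      | _ n ihn =>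
        cases hfa : f a with
        | none => exact halting_of_stuck hfa
        | some a' =>
          refine halting_of_step hfa ?_
          obtain ⟨b', hR, hb | ⟨rfl, hlt⟩⟩ := hstep a b a' hab hfa
          · exact ih b' (Relation.transGen_swap.1 hb) hR
          · exact ihn _ (hn ▸ hlt) hR rfl

end Determinism

namespace Compiler

open Src Tgt Tgt.Instr Tgt.Reg

/-! ### Layout of a compartment -/

theorem flatten_eq_take_append_getElem {α : Type*} (X : List (List α)) (k : ℕ)
    (hk : k < X.length) :
    X.flatten = (X.take k).flatten ++ X[k] ++ (X.drop (k + 1)).flatten := by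
  conv_lhs => rw [← List.take_append_drop k X, List.drop_eq_getElem_cons hk]
  rw [List.flatten_append, List.flatten_cons, List.append_assoc]

/-- The first address of the code. -/
def codeBase (c : Component) : ℤ := 1 + c.buffers.flatten.length

/-- The instruction that the compiler places at an address of the compartment of `C`. -/
def codeMap (C : ℕ) (c : Component) (a : ℤ) : Option Instr :=
  if codeBase c ≤ a then (compCode C c)[(a - codeBase c).toNat]? else none

/-- The instructions `l` are placed from address `p` on. -/
def CodeAt (f : ℤ → Option Instr) (p : ℤ) : List Instr → Prop
  | [] => True
  | i :: l => f p = some i ∧ CodeAt f (p + 1) l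

theorem codeAt_append {f : ℤ → Option Instr} {p : ℤ} {l₁ l₂ : List Instr} :
    CodeAt f p (l₁ ++ l₂) ↔ CodeAt f p l₁ ∧ CodeAt f (p + l₁.length) l₂ := by
  induction l₁ generalizing p with
  | nil => simp [CodeAt]
  | cons i l ih =>
    simp only [List.cons_append, CodeAt, ih, List.length_cons, Nat.cast_add, Nat.cast_one,
      and_assoc]
    rw [show p + 1 + (l.length : ℤ) = p + (l.length + 1) by ring]

theorem codeAt_of_getElem {f : ℤ → Option Instr} {p : ℤ} {l : List Instr}
    (h : ∀ (j : ℕ) i, l[j]? = some i → f (p + j) = some i) : CodeAt f p l := by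
  induction l generalizing p with
  | nil => trivial
  | cons i l ih =>
    refine ⟨by simpa using h 0 i rfl, ih fun j i' hj => ?_⟩
    have := h (j + 1) i' (by simpa using hj)
    rw [← this]
    congr 1
    push_cast
    ring

theorem codeAt_of_compCode {C : ℕ} {c : Component} {pre l post : List Instr}
    (h : compCode C c = pre ++ l ++ post) : CodeAt (codeMap C c) (codeBase c + pre.length) l := by
  refine codeAt_of_getElem fun j i hj => ?_
  have hj' : j < l.length := (List.getElem?_eq_some_iff.1 hj).1
  have : (codeBase c + pre.length + j - codeBase c).toNat = pre.length + j := by omega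
  rw [codeMap, if_pos (by omega), this, h, List.append_assoc, List.getElem?_append_right (by omega),
    List.getElem?_append_left (by omega), ← hj]
  congr 1
  omega

theorem length_compileExpr {env env' : Env} (h : env.self = env'.self) (e : Expr) :
    (compileExpr env e).length = (compileExpr env' e).length := by
  induction e with
  | call C P e ih =>
    simp only [compileExpr, List.length_append, ih, h]
    split <;> simp [saveArg, restoreArg, saveSp, clean, restoreSp, pop, push]
  | _ => simp_all [compileExpr, push, pop]

/-- The size used to lay out the code does not depend on the addresses in it. -/
theorem length_procCode {C : ℕ} {env : Env} (h : env.self = C) (p : ℤ) (e : Expr) :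
    (procCode env p e).length = procSize C e := by
  have := length_compileExpr (env := env) (env' := ⟨C, fun _ => 0, fun _ => 0⟩) h e
  simp [procSize, procCode, localCode, stub, this]

theorem codeAt_entryPoint {C : ℕ} {c : Component} {k : ℕ} {e : Expr} (h : c.procs[k]? = some e) :
    CodeAt (codeMap C c) (entryPoint C c k) (procCode (compEnv C c) (localEntry C c k) e) := by
  obtain ⟨hk, rfl⟩ := List.getElem?_eq_some_iff.1 h
  have hsplit := flatten_eq_take_append_getElem
    (c.procs.zipIdx.map fun q => procCode (compEnv C c) (localEntry C c q.2) q.1) k (by simpa)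
  have hlen : ((c.procs.zipIdx.map fun q =>
      procCode (compEnv C c) (localEntry C c q.2) q.1).map List.length) =
      c.procs.map (procSize C) := by
    rw [List.map_map]
    conv_rhs => rw [← List.zipIdx_map_fst 0 c.procs, List.map_map]
    exact List.map_congr_left fun q _ => length_procCode rfl _ _
  have := codeAt_of_compCode (C := C) (c := c) hsplit
  rw [List.length_flatten, List.map_take, hlen, ← List.map_take] at this
  simpa [entryPoint, codeBase] using this

theorem stackBase_eq (C : ℕ) (c : Component) :
    stackBase C c = codeBase c + (compCode C c).length := rfl

theorem codeBase_pos (c : Component) : 0 < codeBase c := by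
  unfold codeBase
  omega

theorem codeBase_le_stackBase (C : ℕ) (c : Component) : codeBase c ≤ stackBase C c := by
  rw [stackBase_eq]
  omega

theorem codeMap_eq_none_of_lt {C : ℕ} {c : Component} {a : ℤ} (h : a < codeBase c) :
    codeMap C c a = none := by
  simp [codeMap, h]

theorem codeMap_eq_none_of_ge {C : ℕ} {c : Component} {a : ℤ} (h : stackBase C c ≤ a) :
    codeMap C c a = none := by
  have := codeBase_le_stackBase C c
  rw [stackBase_eq] at *
  rw [codeMap, if_pos (by omega), List.getElem?_eq_none (by omega)]

theorem bufAddr_pos (c : Component) (b : ℕ) : 0 < bufAddr c b := by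
  unfold bufAddr
  omega

theorem bufAddr_succ {c : Component} {b : ℕ} (h : b < c.buffers.length) :
    bufAddr c (b + 1) = bufAddr c b + c.buffers[b].length := by
  simp only [bufAddr, List.take_add_one, List.getElem?_eq_getElem h, Option.toList_some,
    List.flatten_append, List.length_append, List.flatten_singleton]
  push_cast
  ring

theorem bufAddr_mono (c : Component) : Monotone (bufAddr c) := by
  refine monotone_nat_of_le_succ fun b => ?_
  by_cases h : b < c.buffers.length
  · rw [bufAddr_succ h]
    omega
  · simp [bufAddr, List.take_of_length_le (Nat.le_of_not_lt h),
      List.take_of_length_le (Nat.le_succ_of_le (Nat.le_of_not_lt h))]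

theorem bufAddr_le_codeBase (c : Component) (b : ℕ) : bufAddr c b ≤ codeBase c := by
  refine (bufAddr_mono c (Nat.le_add_right b c.buffers.length)).trans ?_
  simp [bufAddr, codeBase, List.take_of_length_le]

/-- Cell `i` of buffer `b` exists. -/
def InBuf (c : Component) (b i : ℕ) : Prop := ∃ h : b < c.buffers.length, i < c.buffers[b].length

theorem InBuf.add_lt {c : Component} {b i : ℕ} (h : InBuf c b i) :
    bufAddr c b + i < bufAddr c (b + 1) := by
  obtain ⟨hb, hi⟩ := h
  rw [bufAddr_succ hb]
  omega

theorem InBuf.lt_codeBase {c : Component} {b i : ℕ} (h : InBuf c b i) :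
    bufAddr c b + i < codeBase c :=
  h.add_lt.trans_le (bufAddr_le_codeBase c _)

theorem InBuf.injective {c : Component} {b b' i i' : ℕ} (h : InBuf c b i) (h' : InBuf c b' i')
    (heq : bufAddr c b + i = bufAddr c b' + i') : b = b' ∧ i = i' := by
  rcases lt_trichotomy b b' with hlt | rfl | hlt
  · have := bufAddr_mono c (Nat.succ_le_of_lt hlt)
    have := h.add_lt
    simp only [Nat.succ_eq_add_one] at *
    omega
  · exact ⟨rfl, by omega⟩
  · have := bufAddr_mono c (Nat.succ_le_of_lt hlt)
    have := h'.add_lt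
    simp only [Nat.succ_eq_add_one] at *
    omega

/-! ### Representation of a component in its compartment -/

/-- The list `l`, whose head is the top, is stored as an upward-growing stack from `base` on. -/
def StackAt (m : Mem) (base : ℤ) : List ℤ → Prop
  | [] => True
  | v :: l => m (base + l.length) = v ∧ StackAt m base l

theorem StackAt.congr {m m' : Mem} {base : ℤ} {l : List ℤ} (h : StackAt m base l)
    (hm : ∀ a, base ≤ a → a < base + l.length → m' a = m a) : StackAt m' base l := by
  induction l with
  | nil => trivial
  | cons v l ih =>
    refine ⟨?_, ih h.2 fun a ha ha' => hm a ha (by simp; omega)⟩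
    rw [hm _ (by omega) (by simp)]
    exact h.1

/-- The memory `m` of the compartment of `C` holds the compiled code of `C`, the buffer contents
`bufs` and the local stack `l`. -/
structure CompInv (D : Coding) (C : ℕ) (c : Component) (m : Mem) (bufs : List (List ℤ))
    (l : List ℤ) : Prop where
  code : ∀ a i, codeMap C c a = some i → m a = D.encode i
  shape : bufs.map List.length = c.buffers.map List.length
  cells : ∀ (b : ℕ) buf (i : ℕ) v, bufs[b]? = some buf → buf[i]? = some v →
    m (bufAddr c b + i) = v
  stack : StackAt m (stackBase C c) l

theorem inBuf_of_shape {c : Component} {bufs : List (List ℤ)}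
    (h : bufs.map List.length = c.buffers.map List.length) {b i : ℕ} {buf : List ℤ}
    (hb : bufs[b]? = some buf) (hi : i < buf.length) : InBuf c b i := by
  have h1 := congrArg (fun l => l[b]?) h
  simp only [List.getElem?_map, hb, Option.map_some] at h1
  obtain ⟨buf', hb', hlen⟩ := Option.map_eq_some_iff.1 h1.symm
  obtain ⟨hlt, rfl⟩ := List.getElem?_eq_some_iff.1 hb'
  exact ⟨hlt, by omega⟩

section CompInv

variable {D : Coding} {C : ℕ} {c : Component} {m : Mem} {bufs : List (List ℤ)} {l : List ℤ}

/-- Cell `0` belongs to none of the areas that `CompInv` describes. -/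
theorem CompInv.update_zero (h : CompInv D C c m bufs l) (v : ℤ) :
    CompInv D C c (Function.update m 0 v) bufs l where
  code a i ha := by
    rw [Function.update_of_ne, h.code a i ha]
    rintro rfl
    simp [codeMap_eq_none_of_lt (codeBase_pos c)] at ha
  shape := h.shape
  cells b buf i w hb hi := by
    rw [Function.update_of_ne, h.cells b buf i w hb hi]
    have := bufAddr_pos c b
    omega
  stack := h.stack.congr fun a ha _ => by
    have := codeBase_pos c
    have := codeBase_le_stackBase C c
    rw [Function.update_of_ne (by omega)]

theorem CompInv.push (h : CompInv D C c m bufs l) (v : ℤ) :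
    CompInv D C c (Function.update m (stackBase C c + l.length) v) bufs (v :: l) where
  code a i ha := by
    rw [Function.update_of_ne, h.code a i ha]
    rintro rfl
    simp [codeMap_eq_none_of_ge (c := c) (C := C) (a := stackBase C c + l.length) (by omega)] at ha
  shape := h.shape
  cells b buf i w hb hi := by
    rw [Function.update_of_ne, h.cells b buf i w hb hi]
    have := (inBuf_of_shape h.shape hb (List.getElem?_eq_some_iff.1 hi).1).lt_codeBase
    have := codeBase_le_stackBase C c
    omega
  stack := ⟨by simp, h.stack.congr fun a _ ha => by rw [Function.update_of_ne (by omega)]⟩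

theorem CompInv.pop {v : ℤ} (h : CompInv D C c m bufs (v :: l)) : CompInv D C c m bufs l :=
  { h with stack := h.stack.2 }

theorem CompInv.write (h : CompInv D C c m bufs l) {b i : ℕ} {buf : List ℤ}
    (hb : bufs[b]? = some buf) (hi : i < buf.length) (v : ℤ) :
    CompInv D C c (Function.update m (bufAddr c b + i) v)
      (bufs.modify b fun buf => buf.set i v) l where
  code a j ha := by
    rw [Function.update_of_ne, h.code a j ha]
    rintro rfl
    simp [codeMap_eq_none_of_lt (inBuf_of_shape h.shape hb hi).lt_codeBase] at ha
  shape := by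
    rw [← h.shape]
    refine List.ext_getElem (by simp) fun n h1 h2 => ?_
    simp only [List.getElem_map, List.getElem_modify]
    split <;> simp
  cells b' buf' i' w hb' hi' := by
    rw [List.getElem?_modify] at hb'
    have hin := inBuf_of_shape h.shape hb hi
    by_cases hbb : b = b'
    · subst hbb
      simp only [hb, if_true, Option.map_some, Option.some.injEq, Option.map_eq_map] at hb'
      subst hb'
      rw [List.getElem?_set] at hi'
      by_cases hii : i = i'
      · subst hii
        simpa [hi] using hi'
      · rw [if_neg hii] at hi'
        rw [Function.update_of_ne (by omega)]
        exact h.cells b buf i' w hb hi'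
    · simp only [hbb, if_false, Option.map_eq_map, Option.map_id_fun', id_eq] at hb'
      rw [Function.update_of_ne]
      · exact h.cells b' buf' i' w hb' hi'
      · intro heq
        exact hbb ((inBuf_of_shape h.shape hb' (List.getElem?_eq_some_iff.1 hi').1).injective
          hin heq).1.symm
  stack := h.stack.congr fun a ha _ => by
    have := (inBuf_of_shape h.shape hb hi).lt_codeBase
    have := codeBase_le_stackBase C c
    rw [Function.update_of_ne (by omega)]

end CompInv

/-- The initial memory of a compartment represents its component, with an empty local stack. -/
theorem compInv_compMem (D : Coding) (C : ℕ) (c : Component) :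
    CompInv D C c (compMem D C c) c.buffers [] where
  code a i ha := by
    have hpos := codeBase_pos c
    have hle : codeBase c ≤ a := by
      by_contra hlt
      simp [codeMap_eq_none_of_lt (not_le.1 hlt)] at ha
    rw [codeMap, if_pos hle] at ha
    have hb : codeBase c = 1 + c.buffers.flatten.length := rfl
    obtain ⟨n, hn⟩ : ∃ n : ℕ, a = 1 + c.buffers.flatten.length + n :=
      ⟨(a - codeBase c).toNat, by omega⟩
    have h1 : a.toNat = (c.buffers.flatten.length + n) + 1 := by omega
    have h2 : (a - codeBase c).toNat = n := by omega
    rw [h2] at ha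
    rw [compMem, if_pos (by omega), h1, List.getD_cons_succ,
      List.getD_append_right _ _ _ _ (by omega)]
    simp [ha]
  shape := rfl
  cells b buf i v hb hi := by
    obtain ⟨hlt, rfl⟩ := List.getElem?_eq_some_iff.1 hb
    obtain ⟨hlt', rfl⟩ := List.getElem?_eq_some_iff.1 hi
    have h1 : (bufAddr c b + i).toNat = ((c.buffers.take b).flatten.length + i) + 1 := by
      unfold bufAddr
      omega
    have hsplit := flatten_eq_take_append_getElem c.buffers b hlt
    have := bufAddr_pos c b
    rw [compMem, if_pos (by omega), h1, List.getD_cons_succ, hsplit]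
    simp [List.getElem?_append, hlt']
  stack := trivial

theorem compMem_zero (D : Coding) (C : ℕ) (c : Component) : compMem D C c 0 = stackBase C c := by
  simp [compMem]

/-! ### Straight-line code -/

/-- The effect on compartment memory and registers of a list of register and memory instructions;
execution ends at the first instruction of another kind. -/
def runBlock : List Instr → Mem → (Reg → ℤ) → Mem × (Reg → ℤ)
  | .const i rd :: l, m, g => runBlock l m (Function.update g rd i)
  | .mov rs rd :: l, m, g => runBlock l m (Function.update g rd (g rs))
  | .load rp rd :: l, m, g => runBlock l m (Function.update g rd (m (g rp)))
  | .store rp rs :: l, m, g => runBlock l (Function.update m (g rp) (g rs)) g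
  | .binop op r₁ r₂ rd :: l, m, g => runBlock l m (Function.update g rd (op.eval (g r₁) (g r₂)))
  | _, m, g => (m, g)

/-- The instructions are among those that `runBlock` executes, and none of their stores, executed
in order, hits an address at which `f` places an instruction. -/
def SafeBlock (f : ℤ → Option Instr) : List Instr → Mem → (Reg → ℤ) → Prop
  | [], _, _ => True
  | .const i rd :: l, m, g => SafeBlock f l m (Function.update g rd i)
  | .mov rs rd :: l, m, g => SafeBlock f l m (Function.update g rd (g rs))
  | .load rp rd :: l, m, g => SafeBlock f l m (Function.update g rd (m (g rp)))
  | .store rp rs :: l, m, g =>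
      f (g rp) = none ∧ SafeBlock f l (Function.update m (g rp) (g rs)) g
  | .binop op r₁ r₂ rd :: l, m, g =>
      SafeBlock f l m (Function.update g rd (op.eval (g r₁) (g r₂)))
  | _, _, _ => False

/-- One or more machine steps. -/
abbrev Runs (D : Coding) (ψ : ℕ → Option Interface) (E : ℕ → ℕ → Option ℤ) :
    State → State → Prop :=
  Relation.TransGen fun st st' => Tgt.step D ψ E st = some st'

section

variable {D : Coding} {ψ : ℕ → Option Interface} {E : ℕ → ℕ → Option ℤ}
  {f : ℤ → Option Instr} {C : ℕ} {τ : List (ℕ × ℤ)} {mem : ℕ → Option Mem} {m : Mem}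
  {reg : Reg → ℤ} {pc : ℤ}

theorem step_eq_exec {i : Instr} (hmem : mem C = some m)
    (hcode : ∀ a i, f a = some i → m a = D.encode i) (hi : f pc = some i) :
    Tgt.step D ψ E ⟨C, τ, mem, reg, pc⟩ = exec ψ E ⟨C, τ, mem, reg, pc⟩ m i := by
  simp [Tgt.step, hmem, hcode _ _ hi, D.decode_encode]

theorem runs_block_reflTransGen {l : List Instr} (hmem : mem C = some m)
    (hcode : ∀ a i, f a = some i → m a = D.encode i) (hl : CodeAt f pc l)
    (hsafe : SafeBlock f l m reg) :
    Relation.ReflTransGen (fun st st' => Tgt.step D ψ E st = some st') ⟨C, τ, mem, reg, pc⟩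
      ⟨C, τ, Function.update mem C (some (runBlock l m reg).1), (runBlock l m reg).2,
        pc + l.length⟩ := by
  induction l generalizing mem m reg pc with
  | nil =>
    simp only [runBlock, List.length_nil, Nat.cast_zero, add_zero]
    rw [← hmem, Function.update_eq_self]
  | cons i l ih =>
    have hstep := step_eq_exec (ψ := ψ) (E := E) (τ := τ) (reg := reg) hmem hcode hl.1
    rw [List.length_cons, Nat.cast_add, Nat.cast_one, add_comm (l.length : ℤ), ← add_assoc]
    cases i with
    | store rp rs =>
      have hcode' : ∀ a i, f a = some i →
          Function.update m (reg rp) (reg rs) a = D.encode i := by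
        intro a i ha
        rw [Function.update_of_ne, hcode a i ha]
        rintro rfl
        simp [hsafe.1] at ha
      have := ih (mem := Function.update mem C (some (Function.update m (reg rp) (reg rs))))
        (by simp) hcode' hl.2 hsafe.2
      rw [Function.update_idem] at this
      exact .head hstep this
    | const | mov | load | binop => exact .head hstep (ih hmem hcode hl.2 hsafe)
    | _ => exact hsafe.elim

theorem runs_block {i : Instr} {l : List Instr} (hmem : mem C = some m)
    (hcode : ∀ a i, f a = some i → m a = D.encode i) (hl : CodeAt f pc (i :: l))
    (hsafe : SafeBlock f (i :: l) m reg) :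
    Runs D ψ E ⟨C, τ, mem, reg, pc⟩
      ⟨C, τ, Function.update mem C (some (runBlock (i :: l) m reg).1),
        (runBlock (i :: l) m reg).2, pc + (i :: l).length⟩ := by
  rcases Relation.reflTransGen_iff_eq_or_transGen.1
    (runs_block_reflTransGen (ψ := ψ) (E := E) (τ := τ) hmem hcode hl hsafe) with h | h
  · -- An empty run would leave the program counter unchanged.
    have := congrArg State.pc h
    simp only [List.length_cons] at this
    omega
  · exact h

end

/-! ### Source buffers -/

theorem get_eq_some_iff {s : BufState} {C b : ℕ} {i v : ℤ} :
    s.get C b i = some v ↔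
      ∃ (n : ℕ) (buf : List ℤ), i = n ∧ (s C)[b]? = some buf ∧ buf[n]? = some v := by
  unfold BufState.get
  constructor
  · intro h
    split at h
    · next hi =>
      obtain ⟨buf, hb, hv⟩ := Option.bind_eq_some_iff.1 h
      exact ⟨i.toNat, buf, (Int.toNat_of_nonneg hi).symm, hb, hv⟩
    · simp at h
  · rintro ⟨n, buf, rfl, hb, hv⟩
    simp [hb, hv]

theorem exists_of_set_eq_some {s s' : BufState} {C b : ℕ} {i v : ℤ} (h : s.set C b i v = some s') :
    ∃ (n : ℕ) (buf : List ℤ), i = n ∧ (s C)[b]? = some buf ∧ n < buf.length ∧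
      s' = Function.update s C ((s C).modify b fun buf => buf.set n v) := by
  unfold BufState.set at h
  split at h
  · next hs =>
    obtain ⟨w, hw⟩ := Option.isSome_iff_exists.1 hs
    obtain ⟨n, buf, rfl, hb, hv⟩ := get_eq_some_iff.1 hw
    exact ⟨n, buf, rfl, hb, (List.getElem?_eq_some_iff.1 hv).1, by simpa using h.symm⟩
  · simp at h

/-! ### Representation of a program in the machine memory -/

/-- Every compartment represents its component, with buffers `s` and local stacks `L`.  Each
component other than `cur` has saved its stack pointer in cell `0`; between two components, when
control has left one and the other has not restored its stack pointer yet, `cur` is `none`. -/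
def MemInv (D : Coding) (W : Src.Program) (mem : ℕ → Option Mem) (s : BufState) (L : ℕ → List ℤ)
    (cur : Option ℕ) : Prop :=
  ∀ C c, W C = some c → ∃ m, mem C = some m ∧ CompInv D C c m (s C) (L C) ∧
    (cur ≠ some C → m 0 = stackBase C c + (L C).length)

section

variable {D : Coding} {ψ : ℕ → Option Interface} {E : ℕ → ℕ → Option ℤ} {W : Src.Program}
  {mem : ℕ → Option Mem} {s s' : BufState} {L L' : ℕ → List ℤ} {cur cur' : Option ℕ}
  {C : ℕ} {c : Component} {m m' : Mem} {τ : List (ℕ × ℤ)} {reg : Reg → ℤ} {pc : ℤ}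

/-- If control is in `C` or between two components, the invariant may be reestablished by looking
at the compartment of `C` only: all others have saved their stack pointers. -/
theorem MemInv.update (h : MemInv D W mem s L cur) (hW : W C = some c)
    (hs : ∀ C', C' ≠ C → s' C' = s C') (hL : ∀ C', C' ≠ C → L' C' = L C')
    (hm : CompInv D C c m' (s' C) (L' C))
    (hsp : cur' ≠ some C → m' 0 = stackBase C c + (L' C).length)
    (hcur : ∀ C', C' ≠ C → cur ≠ some C') :
    MemInv D W (Function.update mem C (some m')) s' L' cur' := by
  intro C' c' hW'
  by_cases hC : C' = C
  · subst hC
    obtain rfl : c = c' := Option.some.inj (hW.symm.trans hW')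
    exact ⟨m', by simp, hm, hsp⟩
  · obtain ⟨m, hm, hinv, h0⟩ := h C' c' hW'
    refine ⟨m, by simp [hC, hm], ?_, fun _ => ?_⟩
    · rwa [hs C' hC, hL C' hC]
    · rw [hL C' hC]
      exact h0 (hcur C' hC)

theorem MemInv.update_current (h : MemInv D W mem s L (some C)) (hW : W C = some c)
    (hs : ∀ C', C' ≠ C → s' C' = s C') {l : List ℤ} (hm : CompInv D C c m' (s' C) l) :
    MemInv D W (Function.update mem C (some m')) s' (Function.update L C l) (some C) :=
  h.update hW hs (fun C' h' => by simp [h']) (by simpa using hm) (by simp)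
    (fun C' h' => by simpa using h'.symm)

theorem safe_of_stack {p : ℤ} {n : ℕ} (h : p = stackBase C c + n) : codeMap C c p = none :=
  codeMap_eq_none_of_ge (by omega)

/-! ### Execution of the code fragments -/

theorem runs_push (r : Reg) (h : MemInv D W mem s L (some C)) (hW : W C = some c)
    (hcode : CodeAt (codeMap C c) pc (push r)) (hsp : reg sp = stackBase C c + (L C).length) :
    ∃ mem' reg', Runs D ψ E ⟨C, τ, mem, reg, pc⟩ ⟨C, τ, mem', reg', pc + (push r).length⟩ ∧
      MemInv D W mem' s (Function.update L C (reg r :: L C)) (some C) ∧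
      reg' com = reg com ∧ reg' sp = stackBase C c + (reg r :: L C).length := by
  obtain ⟨m, hm, hinv, -⟩ := h C c hW
  refine ⟨_, _, runs_block hm hinv.code hcode ⟨safe_of_stack hsp, trivial⟩,
    h.update_current hW (fun _ _ => rfl) ?_, ?_, ?_⟩
  · simpa [runBlock, hsp] using hinv.push (reg r)
  · simp [runBlock]
  · simp [runBlock, hsp, BinOp.eval]
    ring

/-- The second operand is in `com`, the first on top of the local stack. -/
theorem runs_binR {op : BinOp} {i : ℤ} {l : List ℤ} (h : MemInv D W mem s L (some C))
    (hW : W C = some c)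
    (hcode : CodeAt (codeMap C c) pc (pop aux₁ ++ [binop op aux₁ com com]))
    (hsp : reg sp = stackBase C c + (L C).length) (hl : L C = i :: l) :
    ∃ mem' reg', Runs D ψ E ⟨C, τ, mem, reg, pc⟩
        ⟨C, τ, mem', reg', pc + (pop aux₁ ++ [binop op aux₁ com com]).length⟩ ∧
      MemInv D W mem' s (Function.update L C l) (some C) ∧
      reg' com = op.eval i (reg com) ∧ reg' sp = stackBase C c + l.length := by
  obtain ⟨m, hm, hinv, -⟩ := h C c hW
  rw [hl] at hinv hsp
  have htop := hinv.stack.1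
  have e1 : stackBase C c + ((l.length : ℤ) + 1) - 1 = stackBase C c + l.length := by ring
  refine ⟨_, _, runs_block hm hinv.code hcode ⟨⟩, h.update_current hW (fun _ _ => rfl) ?_, ?_, ?_⟩
  · simpa [runBlock] using hinv.pop
  · simp [runBlock, hsp, BinOp.eval, e1, htop]
  · simp [runBlock, hsp, BinOp.eval, e1]

theorem runs_pop_ra {r : ℤ} {l : List ℤ} (h : MemInv D W mem s L (some C)) (hW : W C = some c)
    (hcode : CodeAt (codeMap C c) pc (pop ra ++ [jump ra]))
    (hsp : reg sp = stackBase C c + (L C).length) (hl : L C = r :: l) :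
    ∃ mem' reg', Runs D ψ E ⟨C, τ, mem, reg, pc⟩ ⟨C, τ, mem', reg', r⟩ ∧
      MemInv D W mem' s (Function.update L C l) (some C) ∧
      reg' com = reg com ∧ reg' sp = stackBase C c + l.length := by
  obtain ⟨m, hm, hinv, -⟩ := h C c hW
  rw [hl] at hinv hsp
  have htop := hinv.stack.1
  have e1 : stackBase C c + ((l.length : ℤ) + 1) - 1 = stackBase C c + l.length := by ring
  obtain ⟨hpop, hjump, -⟩ := codeAt_append.1 hcode
  have hrun := runs_block (ψ := ψ) (E := E) (τ := τ) hm hinv.code hpop (reg := reg) ⟨⟩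
  have hm' : (runBlock (pop ra) m reg).1 = m := by simp [pop, runBlock]
  have hstep := step_eq_exec (ψ := ψ) (E := E) (τ := τ) (reg := (runBlock (pop ra) m reg).2)
    (mem := Function.update mem C (some m)) (m := m) (C := C) (by simp) hinv.code hjump
  refine ⟨Function.update mem C (some m), (runBlock (pop ra) m reg).2, hrun.tail ?_,
    h.update_current hW (m' := m) (fun _ _ => rfl) hinv.pop, ?_, ?_⟩
  · change Tgt.step D ψ E ⟨C, τ, Function.update mem C (some (runBlock (pop ra) m reg).1),
      (runBlock (pop ra) m reg).2, pc + (pop ra).length⟩ = _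
    rw [hm', hstep]
    simp [exec, pop, runBlock, hsp, BinOp.eval, e1, htop]
  · simp [pop, runBlock]
  · simp [pop, runBlock, hsp, BinOp.eval, e1]

theorem runs_read {b : ℕ} {v : ℤ} (h : MemInv D W mem s L (some C)) (hW : W C = some c)
    (hcode : CodeAt (codeMap C c) pc
      [const (bufAddr c b) aux₁, binop .add aux₁ com aux₁, load aux₁ com])
    (hv : s.get C b (reg com) = some v) :
    ∃ mem' reg', Runs D ψ E ⟨C, τ, mem, reg, pc⟩ ⟨C, τ, mem', reg', pc + 3⟩ ∧
      MemInv D W mem' s L (some C) ∧ reg' com = v ∧ reg' sp = reg sp := by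
  obtain ⟨m, hm, hinv, -⟩ := h C c hW
  obtain ⟨n, buf, hn, hb, hbv⟩ := get_eq_some_iff.1 hv
  have hcell := hinv.cells b buf n v hb hbv
  have hmem := h.update_current hW (fun _ _ => rfl) (l := L C) hinv
  rw [Function.update_eq_self] at hmem
  refine ⟨_, _, runs_block hm hinv.code hcode ⟨⟩, hmem, ?_, ?_⟩
  · simp [runBlock, BinOp.eval, hn, hcell]
  · simp [runBlock]

theorem MemInv.write (h : MemInv D W mem s L (some C)) (hW : W C = some c)
    {b : ℕ} {i v : ℤ} {l : List ℤ} (hL : CompInv D C c m (s C) l)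
    (hs : s.set C b i v = some s') :
    MemInv D W (Function.update mem C (some (Function.update m (bufAddr c b + i) v))) s'
      (Function.update L C l) (some C) ∧ codeMap C c (bufAddr c b + i) = none := by
  obtain ⟨n, buf, rfl, hb, hn, rfl⟩ := exists_of_set_eq_some hs
  refine ⟨h.update_current hW (fun C' h' => by simp [h']) ?_, ?_⟩
  · simpa using hL.write hb hn v
  · exact codeMap_eq_none_of_lt (inBuf_of_shape hL.shape hb hn).lt_codeBase

/-- The assigned value is in `com`, the index on top of the local stack. -/
theorem runs_writeR {b : ℕ} {i : ℤ} {l : List ℤ} (h : MemInv D W mem s L (some C))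
    (hW : W C = some c)
    (hcode : CodeAt (codeMap C c) pc
      (pop aux₁ ++ [const (bufAddr c b) aux₂, binop .add aux₁ aux₂ aux₁, store aux₁ com]))
    (hsp : reg sp = stackBase C c + (L C).length) (hl : L C = i :: l)
    (hs : s.set C b i (reg com) = some s') :
    ∃ mem' reg', Runs D ψ E ⟨C, τ, mem, reg, pc⟩ ⟨C, τ, mem', reg', pc + 6⟩ ∧
      MemInv D W mem' s' (Function.update L C l) (some C) ∧
      reg' com = reg com ∧ reg' sp = stackBase C c + l.length := by
  obtain ⟨m, hm, hinv, -⟩ := h C c hW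
  rw [hl] at hinv hsp
  have htop := hinv.stack.1
  have e1 : stackBase C c + ((l.length : ℤ) + 1) - 1 = stackBase C c + l.length := by ring
  obtain ⟨hmem, hsafe⟩ := h.write hW hinv.pop hs
  have e2 := add_comm i (bufAddr c b)
  refine ⟨_, _, runs_block hm hinv.code hcode ?_, ?_, ?_, ?_⟩
  · simp [SafeBlock, hsp, BinOp.eval, e1, htop, e2, hsafe]
  · simpa [runBlock, hsp, BinOp.eval, e1, htop, e2] using hmem
  · simp [runBlock]
  · simp [runBlock, hsp, BinOp.eval, e1]

theorem runs_restoreArg {i : ℤ} {l : List ℤ} (h : MemInv D W mem s L (some C)) (hW : W C = some c)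
    (hcode : CodeAt (codeMap C c) pc (restoreArg (compEnv C c)))
    (hsp : reg sp = stackBase C c + (L C).length) (hl : L C = i :: l)
    (hs : s.set C 0 0 i = some s') :
    ∃ mem' reg', Runs D ψ E ⟨C, τ, mem, reg, pc⟩
        ⟨C, τ, mem', reg', pc + (restoreArg (compEnv C c)).length⟩ ∧
      MemInv D W mem' s' (Function.update L C l) (some C) ∧
      reg' com = reg com ∧ reg' sp = stackBase C c + l.length := by
  obtain ⟨m, hm, hinv, -⟩ := h C c hW
  rw [hl] at hinv hsp
  have htop := hinv.stack.1
  have e1 : stackBase C c + ((l.length : ℤ) + 1) - 1 = stackBase C c + l.length := by ring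
  obtain ⟨hmem, hsafe⟩ := h.write hW hinv.pop hs
  rw [add_zero] at hmem hsafe
  refine ⟨_, _, runs_block hm hinv.code hcode ?_, ?_, ?_, ?_⟩
  · simp [SafeBlock, compEnv, hsafe]
  · simpa [runBlock, hsp, BinOp.eval, e1, htop, compEnv] using hmem
  · simp [runBlock]
  · simp [runBlock, hsp, BinOp.eval, e1]

theorem runs_saveArg {a : ℤ} (h : MemInv D W mem s L (some C)) (hW : W C = some c)
    (hcode : CodeAt (codeMap C c) pc (saveArg (compEnv C c)))
    (hsp : reg sp = stackBase C c + (L C).length) (ha : s.get C 0 0 = some a) :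
    ∃ mem' reg', Runs D ψ E ⟨C, τ, mem, reg, pc⟩
        ⟨C, τ, mem', reg', pc + (saveArg (compEnv C c)).length⟩ ∧
      MemInv D W mem' s (Function.update L C (a :: L C)) (some C) ∧
      reg' com = reg com ∧ reg' sp = stackBase C c + (a :: L C).length := by
  obtain ⟨m, hm, hinv, -⟩ := h C c hW
  obtain ⟨n, buf, hn, hb, hbv⟩ := get_eq_some_iff.1 ha
  obtain rfl : n = 0 := by omega
  have hcell := hinv.cells 0 buf 0 a hb hbv
  rw [Nat.cast_zero, add_zero] at hcell
  refine ⟨_, _, runs_block hm hinv.code hcode ?_,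
    h.update_current hW (fun _ _ => rfl) ?_, ?_, ?_⟩
  · simp [SafeBlock, push, hsp, safe_of_stack rfl]
  · simpa [runBlock, push, hsp, compEnv, hcell] using hinv.push a
  · simp [runBlock, push]
  · simp [runBlock, push, hsp, BinOp.eval]
    ring

/-- When control leaves `C`, every component has saved its stack pointer. -/
theorem runs_saveSp_clean (h : MemInv D W mem s L (some C)) (hW : W C = some c)
    (hcode : CodeAt (codeMap C c) pc (saveSp ++ clean))
    (hsp : reg sp = stackBase C c + (L C).length) :
    ∃ mem' reg', Runs D ψ E ⟨C, τ, mem, reg, pc⟩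
        ⟨C, τ, mem', reg', pc + (saveSp ++ clean).length⟩ ∧
      MemInv D W mem' s L none ∧ reg' com = reg com := by
  obtain ⟨m, hm, hinv, -⟩ := h C c hW
  refine ⟨_, _, runs_block hm hinv.code hcode ?_,
    h.update hW (fun _ _ => rfl) (fun _ _ => rfl) (m' := Function.update m 0 (reg sp))
      (hinv.update_zero _) (by simp [hsp]) (fun C' h' => by simpa using h'.symm), ?_⟩
  · simp [SafeBlock, clean, codeMap_eq_none_of_lt (codeBase_pos c)]
  · simp [runBlock, clean]

theorem runs_restoreSp (h : MemInv D W mem s L none) (hW : W C = some c)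
    (hcode : CodeAt (codeMap C c) pc restoreSp) :
    ∃ mem' reg', Runs D ψ E ⟨C, τ, mem, reg, pc⟩
        ⟨C, τ, mem', reg', pc + restoreSp.length⟩ ∧
      MemInv D W mem' s L (some C) ∧ reg' com = reg com ∧
      reg' sp = stackBase C c + (L C).length := by
  obtain ⟨m, hm, hinv, h0⟩ := h C c hW
  refine ⟨_, _, runs_block hm hinv.code hcode ⟨⟩,
    h.update hW (fun _ _ => rfl) (fun _ _ => rfl) (m' := m) hinv (by simp) (by simp), ?_, ?_⟩
  · simp [runBlock]
  · simp [runBlock, h0]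

theorem runs_jal {p : ℤ} (h : MemInv D W mem s L (some C)) (hW : W C = some c)
    (hcode : CodeAt (codeMap C c) pc [const p aux₁, jal aux₁]) :
    ∃ reg', Runs D ψ E ⟨C, τ, mem, reg, pc⟩ ⟨C, τ, mem, reg', p⟩ ∧
      reg' com = reg com ∧ reg' sp = reg sp ∧ reg' ra = pc + 2 := by
  obtain ⟨m, hm, hinv, -⟩ := h C c hW
  obtain ⟨h1, h2, -⟩ := hcode
  refine ⟨_, .tail (.single (step_eq_exec hm hinv.code h1)) (step_eq_exec hm hinv.code h2), ?_⟩
  simp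
  ring

/-- The prologue of a procedure at its local entry point stores the argument and pushes the
return address. -/
theorem runs_prologue (h : MemInv D W mem s L (some C)) (hW : W C = some c)
    (hcode : CodeAt (codeMap C c) pc
      ([const (bufAddr c 0) aux₁, store aux₁ com] ++ push ra))
    (hsp : reg sp = stackBase C c + (L C).length) (hs : s.set C 0 0 (reg com) = some s') :
    ∃ mem' reg', Runs D ψ E ⟨C, τ, mem, reg, pc⟩ ⟨C, τ, mem', reg', pc + 5⟩ ∧
      MemInv D W mem' s' (Function.update L C (reg ra :: L C)) (some C) ∧
      reg' sp = stackBase C c + (reg ra :: L C).length := by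
  obtain ⟨m, hm, hinv, -⟩ := h C c hW
  obtain ⟨hmem, hsafe⟩ := h.write hW hinv hs
  rw [add_zero, Function.update_eq_self] at hmem
  rw [add_zero] at hsafe
  obtain ⟨h1, h2⟩ := codeAt_append.1 hcode
  have hrun := runs_block (ψ := ψ) (E := E) (τ := τ) (reg := reg) hm hinv.code h1
    (by simp [SafeBlock, hsafe])
  obtain ⟨mem', reg', hrun', hmem', -, hsp'⟩ := runs_push (ψ := ψ) (E := E) (τ := τ)
    (reg := Function.update reg aux₁ (bufAddr c 0)) ra hmem hW h2 (by simpa using hsp)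
  simp only [runBlock, Function.update_self, ne_eq, reduceCtorEq, not_false_eq_true,
    Function.update_of_ne] at hrun hrun' hmem' hsp'
  refine ⟨mem', reg', hrun.trans ?_, hmem', hsp'⟩
  convert hrun' using 2
  simp [push]
  ring

end

/-! ### The simulation relation -/

/-- The code that completes the evaluation of a frame, once the value of the subexpression that
is being evaluated is in register `com`. -/
def frameCode (env : Env) : Frame → List Instr
  | .binL op e₂ =>
      push com ++ compileExpr env e₂ ++ (pop aux₁ ++ [binop op aux₁ com com])
  | .binR op _ => pop aux₁ ++ [binop op aux₁ com com]
  | .ite e₁ e₂ =>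
      [bnz com ((compileExpr env e₂).length + 3)] ++ compileExpr env e₂ ++
      [const 1 aux₁, bnz aux₁ ((compileExpr env e₁).length + 1)] ++ compileExpr env e₁
  | .read b => [const (env.buf b) aux₁, binop .add aux₁ com aux₁, load aux₁ com]
  | .writeL b e₂ =>
      push com ++ compileExpr env e₂ ++
      (pop aux₁ ++ [const (env.buf b) aux₂, binop .add aux₁ aux₂ aux₁, store aux₁ com])
  | .writeR b _ =>
      pop aux₁ ++ [const (env.buf b) aux₂, binop .add aux₁ aux₂ aux₁, store aux₁ com]
  | .call C P =>
      saveArg env ++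
      (if C = env.self then [const (env.loc P) aux₁, jal aux₁]
       else saveSp ++ clean ++ [call C P] ++ restoreSp) ++
      restoreArg env

/-- The intermediate values of a frame that the compiled code keeps on the local stack. -/
def frameTemps : Frame → List ℤ
  | .binR _ i => [i]
  | .writeR _ i => [i]
  | _ => []

/-- The expressions in a frame are well formed, and so is the operation that it performs. -/
def FrameWF (C : ℕ) (c : Component) : Frame → Prop
  | .binL _ e₂ => e₂.WF C c
  | .ite e₁ e₂ => e₁.WF C c ∧ e₂.WF C c
  | .writeL _ e₂ => e₂.WF C c
  | .call C' P => (C' = C ∧ P < c.procs.length) ∨ (C' ≠ C ∧ (C', P) ∈ c.iface.imported)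
  | _ => True

/-- `KMatch C c K p l r`: the code at address `p` of the compartment of `C` carries out the
continuation `K` on the value in `com`, and then returns from the procedure.  The local stack is
`l` at `p` and `r` before the return, when its top is the return address.  The constructor `skip`
accounts for the jump from the end of an `else` branch over the `then` branch. -/
inductive KMatch (C : ℕ) (c : Component) : Cont → ℤ → List ℤ → List ℤ → Prop
  | ret {p : ℤ} {l : List ℤ} (hcode : CodeAt (codeMap C c) p (pop ra ++ [jump ra])) :
      KMatch C c [] p l l
  | frame {F : Frame} {K : Cont} {p : ℤ} {l r : List ℤ} (hwf : FrameWF C c F)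
      (hcode : CodeAt (codeMap C c) p (frameCode (compEnv C c) F))
      (hK : KMatch C c K (p + (frameCode (compEnv C c) F).length) l r) :
      KMatch C c (F :: K) p (frameTemps F ++ l) r
  | skip {K : Cont} {p n : ℤ} {l r : List ℤ}
      (hcode : CodeAt (codeMap C c) p [const 1 aux₁, bnz aux₁ n])
      (hK : KMatch C c K (p + 1 + n) l r) : KMatch C c K p l r

/-- The case of `KMatch` in which no jump has to be taken first. -/
def KHead (C : ℕ) (c : Component) : Cont → ℤ → List ℤ → List ℤ → Prop
  | [], p, l, r => l = r ∧ CodeAt (codeMap C c) p (pop ra ++ [jump ra])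
  | F :: K, p, l, r => FrameWF C c F ∧ CodeAt (codeMap C c) p (frameCode (compEnv C c) F) ∧
      ∃ l', l = frameTemps F ++ l' ∧ KMatch C c K (p + (frameCode (compEnv C c) F).length) l' r

/-- `SMatch W C r σ τ L`: a procedure of `C` that was called with return address `r` in the
source call stack `σ` returns to code that resumes the continuations suspended in `σ`, when the
protected call stack is `τ` and the local stacks, after the return address has been popped, are
`L`.  An element of `σ` for a call within a component has no counterpart in `τ`. -/
inductive SMatch (W : Src.Program) :
    ℕ → ℤ → List (ℕ × ℤ × Cont) → List (ℕ × ℤ) → (ℕ → List ℤ) → Prop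
  | bottom {C : ℕ} {c : Component} {r : ℤ} {L : ℕ → List ℤ} (hW : W C = some c)
      (hcode : CodeAt (codeMap C c) r (saveSp ++ clean ++ [ret])) : SMatch W C r [] [] L
  | inner {C : ℕ} {c : Component} {r r' a : ℤ} {K : Cont} {σ : List (ℕ × ℤ × Cont)}
      {τ : List (ℕ × ℤ)} {L : ℕ → List ℤ} {l l' : List ℤ} (hW : W C = some c)
      (hcode : CodeAt (codeMap C c) r (restoreArg (compEnv C c))) (hL : L C = a :: l)
      (hK : KMatch C c K (r + (restoreArg (compEnv C c)).length) l (r' :: l'))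
      (hS : SMatch W C r' σ τ (Function.update L C l')) : SMatch W C r ((C, a, K) :: σ) τ L
  | cross {C C' : ℕ} {c c' : Component} {r r' p a : ℤ} {K : Cont} {σ : List (ℕ × ℤ × Cont)}
      {τ : List (ℕ × ℤ)} {L : ℕ → List ℤ} {l l' : List ℤ} (hW : W C = some c)
      (hW' : W C' = some c') (hcode : CodeAt (codeMap C c) r (saveSp ++ clean ++ [ret]))
      (hcode' : CodeAt (codeMap C' c') p (restoreSp ++ restoreArg (compEnv C' c')))
      (hL : L C' = a :: l)
      (hK : KMatch C' c' K (p + (restoreSp ++ restoreArg (compEnv C' c')).length) l (r' :: l'))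
      (hS : SMatch W C' r' σ τ (Function.update L C' l')) :
      SMatch W C r ((C', a, K) :: σ) ((C', p) :: τ) L

/-- The machine state with program counter `p` and the given components is ready to carry out
the continuation `K` and then the continuations of the call stack `σ`. -/
def Aligned (D : Coding) (W : Src.Program) (C : ℕ) (s : BufState) (σ : List (ℕ × ℤ × Cont))
    (K : Cont) (τ : List (ℕ × ℤ)) (mem : ℕ → Option Mem) (reg : Reg → ℤ) (p : ℤ) : Prop :=
  ∃ c L r l, W C = some c ∧ MemInv D W mem s L (some C) ∧
    reg sp = stackBase C c + (L C).length ∧ KMatch C c K p (L C) (r :: l) ∧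
    SMatch W C r σ τ (Function.update L C l)

/-- The simulation relation between source configurations and machine states: the machine is
about to run the code of the current expression, or it has already computed its value. -/
inductive Match (D : Coding) (W : Src.Program) : Config → State → Prop
  | eval {C : ℕ} {c : Component} {s : BufState} {σ : List (ℕ × ℤ × Cont)} {K : Cont} {e : Expr}
      {τ : List (ℕ × ℤ)} {mem : ℕ → Option Mem} {reg : Reg → ℤ} {pc : ℤ} (hW : W C = some c)
      (hwf : e.WF C c) (hcode : CodeAt (codeMap C c) pc (compileExpr (compEnv C c) e))
      (h : Aligned D W C s σ K τ mem reg (pc + (compileExpr (compEnv C c) e).length)) :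
      Match D W ⟨C, s, σ, K, e⟩ ⟨C, τ, mem, reg, pc⟩
  | value {C : ℕ} {s : BufState} {σ : List (ℕ × ℤ × Cont)} {K : Cont} {v : ℤ}
      {τ : List (ℕ × ℤ)} {mem : ℕ → Option Mem} {reg : Reg → ℤ} {pc : ℤ} (hv : reg com = v)
      (h : Aligned D W C s σ K τ mem reg pc) :
      Match D W ⟨C, s, σ, K, .val v⟩ ⟨C, τ, mem, reg, pc⟩

section

variable {D : Coding} {ψ : ℕ → Option Interface} {E : ℕ → ℕ → Option ℤ} {W : Src.Program}
  {mem : ℕ → Option Mem} {s s' : BufState} {L : ℕ → List ℤ} {C : ℕ} {c : Component}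
  {τ : List (ℕ × ℤ)} {reg : Reg → ℤ} {pc : ℤ} {σ : List (ℕ × ℤ × Cont)} {K : Cont}

/-- Focusing on the subexpression that is evaluated first takes no machine step. -/
theorem Match.focus {e e₁ : Expr} {F : Frame} {st : State}
    (hcomp : ∀ env, compileExpr env e = compileExpr env e₁ ++ frameCode env F)
    (htemps : frameTemps F = []) (hwf : ∀ c, e.WF C c → e₁.WF C c ∧ FrameWF C c F)
    (hne : ∀ v, e ≠ .val v) (h : Match D W ⟨C, s, σ, K, e⟩ st) :
    Match D W ⟨C, s, σ, F :: K, e₁⟩ st := by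
  cases h with
  | value => exact absurd rfl (hne _)
  | eval hW hwf' hcode h =>
    rw [hcomp, codeAt_append] at hcode
    obtain ⟨c', L, r, l, hW', hmem, hsp, hK, hS⟩ := h
    obtain rfl := Option.some.inj (hW.symm.trans hW')
    refine .eval hW (hwf _ hwf').1 hcode.1 ⟨_, L, r, l, hW, hmem, hsp, ?_, hS⟩
    have := KMatch.frame (hwf _ hwf').2 hcode.2 (K := K) (l := L C) (r := r :: l)
    rw [htemps, List.nil_append] at this
    refine this ?_
    rwa [hcomp, List.length_append, Nat.cast_add, ← add_assoc] at hK

theorem runs_skip {n : ℤ} (hmem : MemInv D W mem s L (some C)) (hW : W C = some c)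
    (hcode : CodeAt (codeMap C c) pc [const 1 aux₁, bnz aux₁ n]) :
    Runs D ψ E ⟨C, τ, mem, reg, pc⟩ ⟨C, τ, mem, Function.update reg aux₁ 1, pc + 1 + n⟩ := by
  obtain ⟨m, hm, hinv, -⟩ := hmem C c hW
  obtain ⟨h1, h2, -⟩ := hcode
  refine .tail (.single (step_eq_exec hm hinv.code h1)) ((step_eq_exec hm hinv.code h2).trans ?_)
  simp [exec]

theorem KMatch.exists_kHead {l r : List ℤ} (hmem : MemInv D W mem s L (some C)) (hW : W C = some c)
    (hK : KMatch C c K pc l r) :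
    ∃ reg' pc', Relation.ReflTransGen (fun st st' => Tgt.step D ψ E st = some st')
        ⟨C, τ, mem, reg, pc⟩ ⟨C, τ, mem, reg', pc'⟩ ∧
      reg' com = reg com ∧ reg' sp = reg sp ∧ KHead C c K pc' l r := by
  -- The continuation ahead may start with several jumps, one for each enclosing `else` branch that
  -- ends here.
  induction hK generalizing reg with
  | ret hcode => exact ⟨reg, _, .refl, rfl, rfl, rfl, hcode⟩
  | frame hwf hcode hK => exact ⟨reg, _, .refl, rfl, rfl, hwf, hcode, _, rfl, hK⟩
  | @skip K p n l r hcode hK ih =>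
    obtain ⟨reg', pc', hrun, hcom, hsp, hK'⟩ := ih (reg := Function.update reg aux₁ 1)
    exact ⟨reg', pc', (runs_skip hmem hW hcode).to_reflTransGen.trans hrun, by simpa using hcom,
      by simpa using hsp, hK'⟩

/-- From a state that matches a value, the machine reaches the code that uses the value. -/
theorem Match.exists_kHead {v : ℤ} {st : State} (h : Match D W ⟨C, s, σ, K, .val v⟩ st) :
    ∃ c L r l τ mem reg pc,
      Relation.ReflTransGen (fun st st' => Tgt.step D ψ E st = some st') st
        ⟨C, τ, mem, reg, pc⟩ ∧
      W C = some c ∧ reg com = v ∧ MemInv D W mem s L (some C) ∧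
      reg sp = stackBase C c + (L C).length ∧ KHead C c K pc (L C) (r :: l) ∧
      SMatch W C r σ τ (Function.update L C l) := by
  cases h with
  | @eval _ c _ _ _ _ τ mem reg pc hW _ hcode h =>
    obtain ⟨c', L, r, l, hW', hmem, hsp, hK, hS⟩ := h
    obtain rfl := Option.some.inj (hW.symm.trans hW')
    obtain ⟨m, hm, hinv, -⟩ := hmem C c hW
    obtain ⟨reg', pc', hrun, hcom', hsp', hK'⟩ := KMatch.exists_kHead (ψ := ψ) (E := E) (τ := τ)
      (reg := Function.update reg com v) hmem hW hK
    exact ⟨c, L, r, l, τ, mem, reg', pc', .head (step_eq_exec hm hinv.code hcode.1) hrun, hW,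
      by simpa using hcom', hmem, by simpa [hsp] using hsp', hK', hS⟩
  | @value _ _ _ _ _ τ mem reg pc hv h =>
    obtain ⟨c, L, r, l, hW, hmem, hsp, hK, hS⟩ := h
    obtain ⟨reg', pc', hrun, hcom', hsp', hK'⟩ := KMatch.exists_kHead (ψ := ψ) (E := E) (τ := τ)
      (reg := reg) hmem hW hK
    exact ⟨c, L, r, l, τ, mem, reg', pc', hrun, hW, hcom'.trans hv, hmem, hsp'.trans hsp, hK', hS⟩

/-! ### Simulation of calls and returns -/

/-- Entering a procedure from its own component, with the return address in `ra`. -/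
theorem runs_localEntry {k : ℕ} {e : Expr} (hW : W C = some c) (hwf : c.WF C)
    (hk : c.procs[k]? = some e) (hmem : MemInv D W mem s L (some C))
    (hsp : reg sp = stackBase C c + (L C).length) (hs : s.set C 0 0 (reg com) = some s')
    (hS : SMatch W C (reg ra) σ τ L) :
    ∃ st', Runs D ψ E ⟨C, τ, mem, reg, localEntry C c k⟩ st' ∧
      Match D W ⟨C, s', σ, [], e⟩ st' := by
  have hcode := (codeAt_append.1 (codeAt_entryPoint (C := C) hk)).2
  change CodeAt _ (localEntry C c k) _ at hcode
  rw [localCode, codeAt_append, codeAt_append, codeAt_append] at hcode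
  obtain ⟨⟨⟨hpro, hbody⟩, hpop⟩, hjump⟩ := hcode
  obtain ⟨mem', reg', hrun, hmem', hsp'⟩ := runs_prologue (ψ := ψ) (E := E) (τ := τ) hmem hW hpro
    hsp hs
  refine ⟨_, hrun, .eval hW (hwf.procs_wf e (List.mem_of_getElem? hk)) hbody
    ⟨c, _, reg ra, L C, hW, hmem', by simpa using hsp', ?_, ?_⟩⟩
  · rw [Function.update_self]
    refine .ret (codeAt_append.2 ⟨?_, ?_⟩)
    · convert hpop using 1
      simp [push]
      ring
    · convert hjump using 1
      simp [push]
      ring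
  · rwa [Function.update_idem, Function.update_eq_self]

/-- Entering a procedure from another component, or at the start of the execution: the procedure
is called locally by its stub, which thus becomes the code that it returns to. -/
theorem runs_entryPoint {k : ℕ} {e : Expr} (hW : W C = some c) (hwf : c.WF C)
    (hk : c.procs[k]? = some e) (hmem : MemInv D W mem s L none)
    (hs : s.set C 0 0 (reg com) = some s')
    (hS : ∀ r, CodeAt (codeMap C c) r (saveSp ++ clean ++ [ret]) → SMatch W C r σ τ L) :
    ∃ st', Runs D ψ E ⟨C, τ, mem, reg, entryPoint C c k⟩ st' ∧
      Match D W ⟨C, s', σ, [], e⟩ st' := by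
  have hcode := (codeAt_append.1 (codeAt_entryPoint (C := C) hk)).1
  have hstub : stub (localEntry C c k) = restoreSp ++ [const (localEntry C c k) aux₁, jal aux₁] ++
      (saveSp ++ clean ++ [ret]) := by simp [stub]
  rw [hstub, codeAt_append, codeAt_append, List.length_append, Nat.cast_add, ← add_assoc] at hcode
  obtain ⟨⟨hrestore, hjal⟩, hback⟩ := hcode
  obtain ⟨mem₁, reg₁, hrun₁, hmem₁, hcom₁, hsp₁⟩ := runs_restoreSp (ψ := ψ) (E := E) (τ := τ)
    (reg := reg) hmem hW hrestore
  obtain ⟨reg₂, hrun₂, hcom₂, hsp₂, hra₂⟩ := runs_jal (ψ := ψ) (E := E) (τ := τ) (reg := reg₁)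
    hmem₁ hW hjal
  obtain ⟨st', hrun₃, hmatch⟩ := runs_localEntry (ψ := ψ) (E := E) (τ := τ) (reg := reg₂) hW hwf hk
    hmem₁ (hsp₂.trans hsp₁) (by rwa [hcom₂, hcom₁]) (hS _ (by rw [hra₂]; exact hback))
  exact ⟨st', hrun₁.trans (hrun₂.trans hrun₃), hmatch⟩

/-- What linking guarantees about a complete program: its components are well formed, the machine
runs with their interfaces, and each imported procedure, and the main one, is made public by a
component of the program. -/
structure Closed (W : Src.Program) (ψ : ℕ → Option Interface) : Prop where
  iface : ∀ C c, W C = some c → ψ C = some c.iface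
  wf : ∀ C c, W C = some c → c.WF C
  imported : ∀ C c, W C = some c → ∀ q ∈ c.iface.imported,
    ∃ c', W q.1 = some c' ∧ q.2 ∈ c'.iface.exported
  main : ∃ c, W mainComp = some c ∧ mainProc ∈ c.iface.exported

theorem compile_entry {k : ℕ} (hW : W C = some c) (hk : k ∈ c.iface.exported) :
    (compile D W).entry C k = some (entryPoint C c k) := by
  simp [compile, hW, hk]

/-- The caller saves the argument of the call in progress in it, which its own frame on the source
call stack holds as well, and control reaches the body of the procedure called. -/
theorem runs_call {C' P' : ℕ} {e : Expr} {a r : ℤ} {l : List ℤ} (hcl : Closed W ψ)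
    (hW : W C = some c) (hmem : MemInv D W mem s L (some C))
    (hsp : reg sp = stackBase C c + (L C).length)
    (hK : KHead C c (.call C' P' :: K) pc (L C) (r :: l))
    (hS : SMatch W C r σ τ (Function.update L C l)) (ha : s.get C 0 0 = some a)
    (hs : s.set C' 0 0 (reg com) = some s') (he : W.body C' P' = some e) :
    ∃ st', Runs D ψ (compile D W).entry ⟨C, τ, mem, reg, pc⟩ st' ∧
      Match D W ⟨C', s', (C, a, K) :: σ, [], e⟩ st' := by
  obtain ⟨hwf, hcode, l', hl', hK⟩ := hK
  obtain rfl : L C = l' := hl'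
  obtain ⟨c', hW', hproc⟩ := Option.bind_eq_some_iff.1 he
  rw [frameCode, codeAt_append, codeAt_append] at hcode
  obtain ⟨⟨hsave, hcall⟩, hrest⟩ := hcode
  obtain ⟨mem₁, reg₁, hrun₁, hmem₁, hcom₁, hsp₁⟩ := runs_saveArg (ψ := ψ)
    (E := (compile D W).entry) (τ := τ) hmem hW hsave hsp ha
  rw [frameCode] at hK
  rcases hwf with ⟨rfl, -⟩ | ⟨hne, himp⟩
  · obtain rfl := Option.some.inj (hW.symm.trans hW')
    rw [if_pos (show C' = (compEnv C' c).self from rfl)] at hcall hrest hK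
    obtain ⟨reg₂, hrun₂, hcom₂, hsp₂, hra₂⟩ := runs_jal (ψ := ψ) (E := (compile D W).entry)
      (τ := τ) (reg := reg₁) hmem₁ hW hcall
    obtain ⟨st', hrun₃, hmatch⟩ := runs_localEntry (ψ := ψ) (E := (compile D W).entry) (τ := τ)
      (reg := reg₂) (σ := (C', a, K) :: σ) hW (hcl.wf _ _ hW) hproc hmem₁
      (by rw [hsp₂, hsp₁, Function.update_self]) (by rwa [hcom₂, hcom₁])
      (.inner (l := L C') (l' := l) (r' := r) hW
        (by
          rw [hra₂]
          simp only [List.length_append, Nat.cast_add, ← add_assoc] at hrest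
          exact hrest)
        (Function.update_self ..)
        (by
          rw [hra₂]
          simp only [List.length_append, Nat.cast_add, ← add_assoc] at hK
          exact hK)
        (by rwa [Function.update_idem]))
    exact ⟨st', hrun₁.trans (hrun₂.trans hrun₃), hmatch⟩
  · rw [if_neg (show ¬ C' = (compEnv C c).self from hne)] at hcall hrest hK
    obtain ⟨c'', hW'', hexp⟩ := hcl.imported C c hW _ himp
    obtain rfl := Option.some.inj (hW'.symm.trans hW'')
    rw [codeAt_append, codeAt_append] at hcall
    obtain ⟨⟨hleave, hcall⟩, hrestore⟩ := hcall
    obtain ⟨mem₂, reg₂, hrun₂, hmem₂, hcom₂⟩ := runs_saveSp_clean (ψ := ψ)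
      (E := (compile D W).entry) (τ := τ) (reg := reg₁) hmem₁ hW hleave
      (by rw [hsp₁, Function.update_self])
    obtain ⟨m, hm, hinv, -⟩ := hmem₂ C c hW
    have hstep := step_eq_exec (ψ := ψ) (E := (compile D W).entry) (τ := τ) (reg := reg₂) hm
      hinv.code hcall.1
    simp only [exec, hcl.iface C c hW, Option.mem_def, Option.some.injEq, exists_eq_left', himp,
      or_true, if_true, compile_entry hW' hexp, Option.bind_some] at hstep
    obtain ⟨st', hrun₃, hmatch⟩ := runs_entryPoint (ψ := ψ) (E := (compile D W).entry)
      (σ := (C, a, K) :: σ)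
      (τ := (C, pc + (saveArg (compEnv C c)).length + (saveSp ++ clean).length + 1) :: τ)
      (reg := reg₂) hW' (hcl.wf _ _ hW') hproc hmem₂ (by rwa [hcom₂, hcom₁])
      fun r₀ hr₀ => .cross (l := L C) (l' := l) (r' := r) hW' hW hr₀
        (by
          rw [codeAt_append]
          simp only [List.length_append, Nat.cast_add, ← add_assoc, List.length_singleton,
            Nat.cast_one] at hrest hrestore ⊢
          exact ⟨hrestore, hrest⟩)
        (Function.update_self ..)
        (by simpa only [List.length_append, Nat.cast_add, ← add_assoc, List.length_singleton,
            Nat.cast_one] using hK)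
        (by rwa [Function.update_idem])
    exact ⟨st', hrun₁.trans (hrun₂.trans (.head hstep hrun₃)), hmatch⟩

theorem runs_return {C' : ℕ} {a r : ℤ} {l : List ℤ} {K' : Cont} (hW : W C = some c)
    (hmem : MemInv D W mem s L (some C)) (hsp : reg sp = stackBase C c + (L C).length)
    (hK : KHead C c [] pc (L C) (r :: l))
    (hS : SMatch W C r ((C', a, K') :: σ) τ (Function.update L C l))
    (hs : s.set C' 0 0 a = some s') :
    ∃ st', Runs D ψ E ⟨C, τ, mem, reg, pc⟩ st' ∧
      Match D W ⟨C', s', σ, K', .val (reg com)⟩ st' := by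
  obtain ⟨hl, hcode⟩ := hK
  obtain ⟨mem₁, reg₁, hrun₁, hmem₁, hcom₁, hsp₁⟩ := runs_pop_ra (ψ := ψ) (E := E) (τ := τ) hmem hW
    hcode hsp hl
  have hsp₁' : reg₁ sp = stackBase C c + (Function.update L C l C).length := by
    rw [hsp₁, Function.update_self]
  clear hl hcode hsp₁ hsp hmem
  generalize Function.update L C l = L₁ at *
  cases hS with
  | inner hW' hcode hL hK hS =>
    obtain rfl := Option.some.inj (hW.symm.trans hW')
    obtain ⟨mem₂, reg₂, hrun₂, hmem₂, hcom₂, hsp₂⟩ := runs_restoreArg (ψ := ψ) (E := E) (τ := τ)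
      hmem₁ hW hcode hsp₁' hL hs
    exact ⟨_, hrun₁.trans hrun₂, .value (hcom₂.trans hcom₁) ⟨_, _, _, _, hW, hmem₂,
      by rw [hsp₂, Function.update_self], by rwa [Function.update_self],
      by rwa [Function.update_idem]⟩⟩
  | @cross _ _ _ c' _ r' p _ _ _ τ' _ l₀ l' hW₀ hW' hcode hcode' hL hK hS =>
    obtain rfl := Option.some.inj (hW.symm.trans hW₀)
    obtain ⟨hleave, hret, -⟩ := codeAt_append.1 hcode
    obtain ⟨hrestore, hrest⟩ := codeAt_append.1 hcode'
    obtain ⟨mem₂, reg₂, hrun₂, hmem₂, hcom₂⟩ := runs_saveSp_clean (ψ := ψ) (E := E)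
      (τ := (C', p) :: τ') (reg := reg₁) hmem₁ hW hleave hsp₁'
    obtain ⟨m, hm, hinv, -⟩ := hmem₂ C c hW
    have hstep := step_eq_exec (ψ := ψ) (E := E) (τ := (C', p) :: τ') (reg := reg₂) hm
      hinv.code hret
    obtain ⟨mem₃, reg₃, hrun₃, hmem₃, hcom₃, hsp₃⟩ := runs_restoreSp (ψ := ψ) (E := E) (τ := τ')
      (reg := reg₂) hmem₂ hW' hrestore
    obtain ⟨mem₄, reg₄, hrun₄, hmem₄, hcom₄, hsp₄⟩ := runs_restoreArg (ψ := ψ) (E := E) (τ := τ')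
      (reg := reg₃) hmem₃ hW' hrest hsp₃ hL hs
    exact ⟨_, hrun₁.trans (hrun₂.trans (.head hstep (hrun₃.trans hrun₄))),
      .value (by rw [hcom₄, hcom₃, hcom₂, hcom₁]) ⟨_, _, _, _, hW', hmem₄,
      by rw [hsp₄, Function.update_self],
      by rwa [Function.update_self, add_assoc, ← Nat.cast_add, ← List.length_append],
      by rwa [Function.update_idem]⟩⟩

/-- Returning from the initial call ends in a state that is stuck on an empty call stack. -/
theorem runs_final {r : ℤ} {l : List ℤ} (hW : W C = some c)
    (hmem : MemInv D W mem s L (some C)) (hsp : reg sp = stackBase C c + (L C).length)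
    (hK : KHead C c [] pc (L C) (r :: l)) (hS : SMatch W C r [] τ (Function.update L C l)) :
    ∃ st', Runs D ψ E ⟨C, τ, mem, reg, pc⟩ st' ∧ Tgt.step D ψ E st' = none := by
  obtain ⟨hl, hcode⟩ := hK
  obtain ⟨mem₁, reg₁, hrun₁, hmem₁, hcom₁, hsp₁⟩ := runs_pop_ra (ψ := ψ) (E := E) (τ := τ) hmem hW
    hcode hsp hl
  have hsp₁' : reg₁ sp = stackBase C c + (Function.update L C l C).length := by
    rw [hsp₁, Function.update_self]
  generalize Function.update L C l = L₁ at *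
  cases hS with
  | bottom hW' hcode =>
    obtain rfl := Option.some.inj (hW.symm.trans hW')
    obtain ⟨hleave, hret, -⟩ := codeAt_append.1 hcode
    obtain ⟨mem₂, reg₂, hrun₂, hmem₂, hcom₂⟩ := runs_saveSp_clean (ψ := ψ) (E := E)
      (τ := []) (reg := reg₁) hmem₁ hW hleave hsp₁'
    obtain ⟨m, hm, hinv, -⟩ := hmem₂ C c hW
    exact ⟨_, hrun₁.trans hrun₂, step_eq_exec hm hinv.code hret⟩

end

/-! ### Simulation of source steps -/

section

variable {D : Coding} {ψ : ℕ → Option Interface} {W : Src.Program} {mem : ℕ → Option Mem}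
  {s : BufState} {L : ℕ → List ℤ} {C : ℕ} {c : Component} {cur : Option ℕ}

theorem Match.step {cfg cfg' : Config} {st : State} (hcl : Closed W ψ) (h : Match D W cfg st)
    (hstep : Src.step W.body cfg = some cfg') :
    ∃ st', Match D W cfg' st' ∧ (Runs D ψ (compile D W).entry st st' ∨
      st' = st ∧ sizeOf cfg'.expr < sizeOf cfg.expr) := by
  obtain ⟨C, s, σ, K, e⟩ := cfg
  cases e with
  | bin op e₁ e₂ =>
    obtain rfl := Option.some.inj hstep
    exact ⟨st, h.focus (e := .bin op e₁ e₂) (by simp [compileExpr, frameCode]) rfl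
      (fun c hc => hc) (by simp), .inr ⟨rfl, by simp; omega⟩⟩
  | ite e e₁ e₂ =>
    obtain rfl := Option.some.inj hstep
    exact ⟨st, h.focus (e := .ite e e₁ e₂) (by simp [compileExpr, frameCode]) rfl
      (fun c hc => hc) (by simp), .inr ⟨rfl, by simp; omega⟩⟩
  | read b e =>
    obtain rfl := Option.some.inj hstep
    exact ⟨st, h.focus (e := .read b e) (by simp [compileExpr, frameCode]) rfl
      (fun c hc => ⟨hc.2, trivial⟩) (by simp), .inr ⟨rfl, by simp⟩⟩
  | write b e₁ e₂ =>
    obtain rfl := Option.some.inj hstep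
    exact ⟨st, h.focus (e := .write b e₁ e₂) (by simp [compileExpr, frameCode]) rfl
      (fun c hc => hc.2) (by simp), .inr ⟨rfl, by simp; omega⟩⟩
  | call C' P' e =>
    obtain rfl := Option.some.inj hstep
    exact ⟨st, h.focus (e := .call C' P' e) (by simp [compileExpr, frameCode]) rfl
      (fun c hc => ⟨hc.2, hc.1⟩) (by simp), .inr ⟨rfl, by simp⟩⟩
  | exit => simp [Src.step] at hstep
  | val v =>
    obtain ⟨c, L, r, l, τ, mem, reg, pc, hrun, hW, rfl, hmem, hsp, hK, hS⟩ :=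
      h.exists_kHead (ψ := ψ) (E := (compile D W).entry)
    suffices ∃ st', Match D W cfg' st' ∧
        Runs D ψ (compile D W).entry ⟨C, τ, mem, reg, pc⟩ st' by
      obtain ⟨st', hmatch, hrun'⟩ := this
      exact ⟨st', hmatch, .inl (Relation.TransGen.trans_right hrun hrun')⟩
    clear h hrun
    cases K with
    | nil =>
      cases σ with
      | nil => simp [Src.step] at hstep
      | cons q σ =>
        obtain ⟨C', a, K⟩ := q
        obtain ⟨s', hs, hstep⟩ := Option.bind_eq_some_iff.1 hstep
        obtain rfl := Option.some.inj hstep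
        obtain ⟨st', hrun, hmatch⟩ := runs_return hW hmem hsp hK hS hs
        exact ⟨st', hmatch, hrun⟩
    | cons F K =>
      cases F with
      | binL op e₂ =>
        obtain rfl := Option.some.inj hstep
        obtain ⟨hwf, hcode, l', hl', hK⟩ := hK
        obtain rfl : L C = l' := hl'
        rw [frameCode, codeAt_append, codeAt_append] at hcode
        obtain ⟨⟨hpush, he⟩, hrest⟩ := hcode
        obtain ⟨mem', reg', hrun, hmem', hcom', hsp'⟩ := runs_push com hmem hW hpush hsp
        refine ⟨_, .eval hW hwf he ⟨c, _, r, l, hW, hmem', by rw [hsp', Function.update_self], ?_,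
          by rwa [Function.update_idem]⟩, hrun⟩
        rw [Function.update_self]
        simp only [frameCode, List.length_append, Nat.cast_add, ← add_assoc] at hrest hK
        refine .frame (F := .binR op (reg com)) trivial hrest ?_
        simpa only [frameCode, List.length_append, Nat.cast_add, ← add_assoc] using hK
      | binR op i =>
        obtain rfl := Option.some.inj hstep
        obtain ⟨-, hcode, l', hl', hK⟩ := hK
        obtain ⟨mem', reg', hrun, hmem', hcom', hsp'⟩ := runs_binR hmem hW hcode hsp hl'
        exact ⟨_, .value hcom' ⟨c, _, r, l, hW, hmem', by rw [hsp', Function.update_self],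
          by rwa [Function.update_self], by rwa [Function.update_idem]⟩, hrun⟩
      | ite e₁ e₂ =>
        obtain rfl := Option.some.inj hstep
        obtain ⟨hwf, hcode, l', hl', hK⟩ := hK
        obtain rfl : L C = l' := hl'
        rw [frameCode, codeAt_append, codeAt_append, codeAt_append] at hcode
        obtain ⟨⟨⟨⟨hbnz, -⟩, he₂⟩, hskip⟩, he₁⟩ := hcode
        obtain ⟨m, hm, hinv, -⟩ := hmem C c hW
        have hbranch := step_eq_exec (ψ := ψ) (E := (compile D W).entry) (τ := τ) (reg := reg) hm
          hinv.code hbnz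
        simp only [exec] at hbranch
        refine ⟨_, ?_, .single hbranch⟩
        simp only [frameCode, List.length_append, Nat.cast_add, ← add_assoc,
          List.length_cons, List.length_nil, zero_add,
          Nat.cast_one, Nat.reduceAdd, Nat.cast_ofNat] at he₁ he₂ hskip hK
        -- The `else` branch comes first in the code, so its end has to jump over the `then` branch.
        by_cases hv : reg com ≠ 0
        · simp only [if_pos hv]
          refine .eval hW hwf.1 (pc := pc + ((compileExpr (compEnv C c) e₂).length + 3)) ?_
            ⟨c, L, r, l, hW, hmem, hsp, ?_, hS⟩
          · convert he₁ using 1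
            ring
          · convert hK using 1
            ring
        · simp only [if_neg hv]
          refine .eval hW hwf.2 he₂ ⟨c, L, r, l, hW, hmem, hsp, .skip hskip ?_, hS⟩
          convert hK using 1
          ring
      | read b =>
        obtain ⟨v, hv, hstep⟩ := Option.bind_eq_some_iff.1 hstep
        obtain rfl := Option.some.inj hstep
        obtain ⟨-, hcode, l', hl', hK⟩ := hK
        obtain rfl : L C = l' := hl'
        obtain ⟨mem', reg', hrun, hmem', hcom', hsp'⟩ := runs_read hmem hW hcode hv
        exact ⟨_, .value hcom' ⟨c, _, r, l, hW, hmem', hsp'.trans hsp, hK, hS⟩, hrun⟩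
      | writeL b e₂ =>
        obtain rfl := Option.some.inj hstep
        obtain ⟨hwf, hcode, l', hl', hK⟩ := hK
        obtain rfl : L C = l' := hl'
        rw [frameCode, codeAt_append, codeAt_append] at hcode
        obtain ⟨⟨hpush, he⟩, hrest⟩ := hcode
        obtain ⟨mem', reg', hrun, hmem', hcom', hsp'⟩ := runs_push com hmem hW hpush hsp
        refine ⟨_, .eval hW hwf he ⟨c, _, r, l, hW, hmem', by rw [hsp', Function.update_self], ?_,
          by rwa [Function.update_idem]⟩, hrun⟩
        rw [Function.update_self]
        simp only [frameCode, List.length_append, Nat.cast_add, ← add_assoc] at hrest hK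
        refine .frame (F := .writeR b (reg com)) trivial hrest ?_
        simpa only [frameCode, List.length_append, Nat.cast_add, ← add_assoc] using hK
      | writeR b i =>
        obtain ⟨s', hs, hstep⟩ := Option.bind_eq_some_iff.1 hstep
        obtain rfl := Option.some.inj hstep
        obtain ⟨-, hcode, l', hl', hK⟩ := hK
        obtain ⟨mem', reg', hrun, hmem', hcom', hsp'⟩ := runs_writeR hmem hW hcode hsp hl' hs
        exact ⟨_, .value hcom' ⟨c, _, r, l, hW, hmem', by rw [hsp', Function.update_self],
          by rwa [Function.update_self], by rwa [Function.update_idem]⟩, hrun⟩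
      | call C' P' =>
        obtain ⟨a, ha, hstep⟩ := Option.bind_eq_some_iff.1 hstep
        obtain ⟨s', hs, hstep⟩ := Option.bind_eq_some_iff.1 hstep
        obtain ⟨e, he, hstep⟩ := Option.bind_eq_some_iff.1 hstep
        obtain rfl := Option.some.inj hstep
        obtain ⟨st', hrun, hmatch⟩ := runs_call hcl hW hmem hsp hK hS ha hs he
        exact ⟨st', hmatch, hrun⟩

theorem exists_arg_of_shape (hwf : c.WF C)
    (hs : (s C).map List.length = c.buffers.map List.length) : ∃ a, s.get C 0 0 = some a := by
  obtain ⟨buf, hb, hlen⟩ := hwf.arg_cell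
  have h1 := congrArg (fun l => l[0]?) hs
  simp only [List.getElem?_map, Option.mem_def.1 hb, Option.map_some] at h1
  obtain ⟨buf', hb', hlen'⟩ := Option.map_eq_some_iff.1 h1
  exact ⟨buf'[0], get_eq_some_iff.2 ⟨0, buf', rfl, hb', by simp [hlen', hlen]⟩⟩

theorem MemInv.exists_arg (h : MemInv D W mem s L cur) (hcl : Closed W ψ) (hW : W C = some c) :
    ∃ a, s.get C 0 0 = some a := by
  obtain ⟨m, -, hinv, -⟩ := h C c hW
  exact exists_arg_of_shape (hcl.wf C c hW) hinv.shape

theorem exists_set_of_get {b : ℕ} {i a : ℤ} (h : s.get C b i = some a) (v : ℤ) :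
    ∃ s', s.set C b i v = some s' := by
  simp [BufState.set, h]

theorem exists_body {k : ℕ} (hW : W C = some c) (hk : k < c.procs.length) :
    ∃ e, W.body C k = some e := by
  simp [Program.body, hW, hk]

/-- A configuration that matches a machine state is stuck only if it is final or if its behavior
is undefined; in the former case the machine gets stuck as well. -/
theorem Match.stuck {cfg : Config} {st : State} (hcl : Closed W ψ) (h : Match D W cfg st)
    (hstep : Src.step W.body cfg = none) (hdef : ¬ cfg.Undef) :
    cfg.Final ∧ ∃ st', Relation.ReflTransGen
      (fun st st' => Tgt.step D ψ (compile D W).entry st = some st') st st' ∧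
      Tgt.step D ψ (compile D W).entry st' = none := by
  obtain ⟨C, s, σ, K, e⟩ := cfg
  cases e with
  | exit =>
    cases h with
    | eval hW hwf hcode h =>
      obtain ⟨c', L, r, l, hW', hmem, -⟩ := h
      obtain ⟨m, hm, hinv, -⟩ := hmem C _ hW
      exact ⟨.inl rfl, _, .refl, step_eq_exec hm hinv.code hcode.1⟩
  | val v =>
    obtain ⟨c, L, r, l, τ, mem, reg, pc, hrun, hW, rfl, hmem, hsp, hK, hS⟩ :=
      h.exists_kHead (ψ := ψ) (E := (compile D W).entry)
    cases K with
    | nil =>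
      cases σ with
      | nil =>
        obtain ⟨st', hrun', hst'⟩ := runs_final (ψ := ψ) (E := (compile D W).entry) hW hmem hsp hK
          hS
        exact ⟨.inr ⟨⟨_, rfl⟩, rfl, rfl⟩, st', hrun.trans hrun'.to_reflTransGen, hst'⟩
      | cons q σ =>
        obtain ⟨C', a, K⟩ := q
        obtain ⟨c', hW'⟩ : ∃ c', W C' = some c' := by
          generalize Function.update L C l = L₁ at hS
          cases hS with
          | inner hW' => exact ⟨_, hW'⟩
          | cross _ hW' => exact ⟨_, hW'⟩
        obtain ⟨a', ha'⟩ := hmem.exists_arg hcl hW'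
        obtain ⟨s', hs'⟩ := exists_set_of_get ha' a
        simp [Src.step, hs'] at hstep
    | cons F K =>
      cases F with
      | binL | binR | ite | writeL => simp [Src.step] at hstep
      | read b =>
        refine absurd (.inl ⟨b, _, K, rfl, rfl, ?_⟩) hdef
        simpa [Src.step, ← Option.eq_none_iff_forall_ne_some] using hstep
      | writeR b i =>
        refine absurd (.inr ⟨b, i, _, K, rfl, rfl, ?_⟩) hdef
        simpa [Src.step, BufState.set] using hstep
      | call C' P' =>
        obtain ⟨c', hW', hP'⟩ : ∃ c', W C' = some c' ∧ P' < c'.procs.length := by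
          rcases hK.1 with ⟨rfl, hP'⟩ | ⟨-, himp⟩
          · exact ⟨c, hW, hP'⟩
          · obtain ⟨c', hW', hexp⟩ := hcl.imported C c hW _ himp
            exact ⟨c', hW', (hcl.wf _ _ hW').exported_defined _ hexp⟩
        obtain ⟨a, ha⟩ := hmem.exists_arg hcl hW
        obtain ⟨a', ha'⟩ := hmem.exists_arg hcl hW'
        obtain ⟨s', hs'⟩ := exists_set_of_get ha' (reg com)
        obtain ⟨e, he⟩ := exists_body hW' hP'
        simp [Src.step, ha, hs', he] at hstep
  | _ => simp [Src.step] at hstep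

theorem memInv_compile (D : Coding) (W : Src.Program) :
    MemInv D W (compile D W).mem W.initBufs (fun _ => []) none := by
  intro C c hW
  refine ⟨compMem D C c, by simp [compile, hW], ?_, fun _ => by simp [compMem_zero]⟩
  simpa [Program.initBufs, hW] using compInv_compMem D C c

theorem exists_match_init (D : Coding) (hcl : Closed W ψ) :
    ∃ cfg st₀ st, W.init = some cfg ∧ (compile D W).init = some st₀ ∧
      Runs D ψ (compile D W).entry st₀ st ∧ Match D W cfg st := by
  obtain ⟨c, hW, hexp⟩ := hcl.main
  obtain ⟨a, ha⟩ := (memInv_compile D W).exists_arg hcl hW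
  obtain ⟨s', hs'⟩ := exists_set_of_get ha 0
  have hwf := hcl.wf _ _ hW
  obtain ⟨e, he⟩ := exists_body hW (hwf.exported_defined _ hexp)
  obtain ⟨st, hrun, hmatch⟩ := runs_entryPoint (ψ := ψ) (E := (compile D W).entry) (τ := [])
    (σ := []) (reg := fun _ => 0) (k := mainProc) hW hwf (by simpa [Program.body, hW] using he)
    (memInv_compile D W) hs' fun r hr => .bottom hW hr
  exact ⟨_, _, st, by simp [Src.Program.init, hs', he],
    by simp [Tgt.Program.init, compile_entry hW hexp], hrun, hmatch⟩

/-! ### Compiler correctness -/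

theorem step_eq_none_of_final {Δ : ℕ → ℕ → Option Expr} {cfg : Config} (h : cfg.Final) :
    Src.step Δ cfg = none := by
  obtain ⟨C, s, σ, K, e⟩ := cfg
  rcases h with h | ⟨⟨i, h⟩, h', h''⟩
  · obtain rfl : e = .exit := h
    simp [Src.step]
  · obtain rfl : e = .val i := h
    obtain rfl : K = [] := h'
    obtain rfl : σ = [] := h''
    simp [Src.step]

/-- Whole-program compiler correctness: a complete program without undefined behavior terminates
or diverges exactly if its compilation does. -/
theorem compile_correct (D : Coding) (hcl : Closed W ψ)
    (hdef : ∀ cfg, W.Reaches cfg → ¬ cfg.Undef) :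
    (W.Terminates ↔ (compile D W).Terminates D ψ) ∧
      (W.Diverges ↔ (compile D W).Diverges D ψ) := by
  obtain ⟨cfg, st₀, st, hcfg, hst₀, hrun, hmatch⟩ := exists_match_init D hcl
  have hsim : Halting (Src.step W.body) cfg ↔
      Halting (Tgt.step D ψ (compile D W).entry) st₀ := by
    rw [halting_iff_of_reflTransGen hrun.to_reflTransGen]
    refine halting_iff_of_simulation (R := fun cfg st => W.Reaches cfg ∧ Match D W cfg st)
      (fun cfg => sizeOf cfg.expr) ?_ ?_ ⟨⟨cfg, hcfg, .refl⟩, hmatch⟩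
    · rintro a b a' ⟨⟨c₀, hc₀, hr⟩, h⟩ hstep
      obtain ⟨b', h', hb'⟩ := h.step hcl hstep
      exact ⟨b', ⟨⟨c₀, hc₀, hr.tail hstep⟩, h'⟩, hb'⟩
    · rintro a b ⟨hr, h⟩ hstep
      exact (h.stuck hcl hstep (hdef a hr)).2
  have hmatches : ∀ a, W.Reaches a → ∃ b, Match D W a b := by
    rintro a ⟨c₀, hc₀, hr⟩
    obtain rfl := Option.some.inj (hcfg.symm.trans hc₀)
    induction hr with
    | refl => exact ⟨st, hmatch⟩
    | tail _ hstep ih =>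
      obtain ⟨b, h⟩ := ih
      obtain ⟨b', h', -⟩ := h.step hcl hstep
      exact ⟨b', h'⟩
  have hsrc : W.Terminates ↔ Halting (Src.step W.body) cfg := by
    rw [halting_iff_exists_stuck]
    constructor
    · rintro ⟨a, ⟨c₀, hc₀, hr⟩, hfinal⟩
      obtain rfl := Option.some.inj (hcfg.symm.trans hc₀)
      exact ⟨a, hr, step_eq_none_of_final hfinal⟩
    · rintro ⟨a, hr, hstep⟩
      have hreach : W.Reaches a := ⟨cfg, hcfg, hr⟩
      obtain ⟨b, h⟩ := hmatches a hreach
      exact ⟨a, hreach, (h.stuck hcl hstep (hdef a hreach)).1⟩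
  have htgt : (compile D W).Terminates D ψ ↔
      Halting (Tgt.step D ψ (compile D W).entry) st₀ := by
    rw [halting_iff_exists_stuck]
    simp [Tgt.Program.Terminates, hst₀]
  have hsrc' : W.Diverges ↔ ¬ Halting (Src.step W.body) cfg := by
    rw [not_halting_iff_exists_run]
    simp [Src.Program.Diverges, hcfg, eq_comm]
  have htgt' : (compile D W).Diverges D ψ ↔
      ¬ Halting (Tgt.step D ψ (compile D W).entry) st₀ := by
    rw [not_halting_iff_exists_run]
    simp [Tgt.Program.Diverges, hst₀, eq_comm]
  rw [hsrc, htgt, hsrc', htgt', hsim]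
  exact ⟨Iff.rfl, Iff.rfl⟩

end

/-! ### Linking -/

/-- Compilation commutes with linking of programs that define no component in common. -/
theorem link_compile (D : Coding) {A P : Src.Program} (h : ∀ C, A C = none ∨ P C = none) :
    Tgt.link (compile D A) (compile D P) = compile D (Src.link A P) := by
  simp only [Tgt.link, compile, Src.link, Tgt.Program.mk.injEq]
  constructor
  · funext C
    cases A C <;> simp
  · funext C k
    rcases h C with h | h <;> simp [h]

/-- A program and a context of complementary shapes form a complete program. -/
theorem closed_link {s : Shape} (hs : s.WF) {A P : Src.Program} (hA : A.CtxHasShape s)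
    (hP : P.HasShape s) : Closed (Src.link A P) s.iface := by
  have hcases : ∀ C c, Src.link A P C = some c → A C = some c ∨ P C = some c := by
    intro C c h
    unfold Src.link at h
    cases hAC : A C with
    | none => simpa [hAC] using h
    | some a => exact .inl (by simpa [hAC] using h)
  have hiface : ∀ C c, Src.link A P C = some c → s.iface C = some c.iface := fun C c h =>
    (hcases C c h).elim (hA.iface C c) (hP.iface C c)
  have hdom : ∀ C I, s.iface C = some I → ∃ c, Src.link A P C = some c ∧ c.iface = I := by
    intro C I hI
    have : (Src.link A P C).isSome := by
      unfold Src.link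
      rw [Option.isSome_or, Bool.or_eq_true, hA.dom, hP.dom]
      by_cases hC : C ∈ s.uncompromised
      · exact .inr ⟨by simp [hI], hC⟩
      · exact .inl ⟨by simp [hI], hC⟩
    obtain ⟨c, hc⟩ := Option.isSome_iff_exists.1 this
    exact ⟨c, hc, Option.some.inj ((hiface C c hc).symm.trans hI)⟩
  refine ⟨hiface, fun C c h => (hcases C c h).elim (hA.wf C c) (hP.wf C c), ?_, ?_⟩
  · intro C c h q hq
    obtain ⟨J, hJ, hexp⟩ := hs.imported_exported C _ (hiface C c h) q hq
    obtain ⟨c', hc', rfl⟩ := hdom _ _ hJ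
    exact ⟨c', hc', hexp⟩
  · obtain ⟨I, hI, hexp⟩ := hs.main_exported
    obtain ⟨c, hc, rfl⟩ := hdom _ _ hI
    exact ⟨c, hc, hexp⟩

theorem disjoint_of_shape {s : Shape} {A P : Src.Program} (hA : A.CtxHasShape s)
    (hP : P.HasShape s) (C : ℕ) : A C = none ∨ P C = none := by
  by_contra! h
  have h1 := (hA.dom C).1 (Option.isSome_iff_ne_none.2 h.1)
  have h2 := (hP.dom C).1 (Option.isSome_iff_ne_none.2 h.2)
  exact h1.2 h2.2

end Compiler

theorem mainTheorem4 (D : Tgt.Coding) (s : Shape) (hs : s.WF) (A P : Src.Program)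
    (hA : A.CtxHasShape s) (hP : P.HasShape s)
    (hPdef : P.FullyDefined s) (hAdef : A.CtxFullyDefined s) :
    ((Src.link A P).Terminates ↔
      (Tgt.link (Compiler.compile D A) (Compiler.compile D P)).Terminates D s.iface) ∧
    ((Src.link A P).Diverges ↔
      (Tgt.link (Compiler.compile D A) (Compiler.compile D P)).Diverges D s.iface) := by
  have hdisj := Compiler.disjoint_of_shape hA hP
  rw [Compiler.link_compile D hdisj]
  refine Compiler.compile_correct D (Compiler.closed_link hs hA hP) fun cfg hreach hundef => ?_
  -- Undefined behavior would have to occur both in a component of `A` and in one of `P`.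
  have h1 := hPdef A hA cfg hreach hundef
  have h2 := hAdef P hP cfg hreach hundef
  rcases hdisj cfg.comp with h | h <;> simp [h] at h1 h2
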